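/- For a finite abelian group $G$ of order $n$, let $s(G)$ be the number of pairs $(\pi_1,\pi_2)$ of bijections $\{1,\dots,n\}\to G$ such that the pointwise sum $\pi_1+\pi_2$ is also a bijection. Then, for every finite abelian group $G$ of odd order $n$, \[ s(G) = \bigl(e^{-1/2}+o(1)\bigr)\,\frac{n!^3}{n^{n-1}}, \] where $o(1)$ denotes a quantity bounded in absolute value by some function $\delta(n)$ that depends only on $n$ (not on the particular group $G$ of order $n$) and satisfies $\delta(n)\to 0$ as $n\to\infty$. -/

import Mathlib

/-- The number of pairs of bijections from a set of `|G|` elements (here `Fin |G|`) to `G`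
whose pointwise sum is again a bijection. -/
noncomputable def additiveTripleCount (G : Type*) [AddCommGroup G] : ℕ :=
  Set.ncard {p : (Fin (Nat.card G) → G) × (Fin (Nat.card G) → G) |
    Function.Bijective p.1 ∧ Function.Bijective p.2 ∧ Function.Bijective (p.1 + p.2)}

/-!
The proof is the circle method on `G ^ n`, in a short form. Write `n = |G|`, let `ι` be an index
set with `n` elements, and for a tuple `χ : ι → AddChar G ℂ` let `bijFourier χ` be the average of
`∏ i, χ i (e i)` over all bijections `e : ι ≃ G`. By orthogonality the number of additive triples
is `n!³ / n ^ n * ∑ χ, (bijFourier χ)³`, so the claim is that `n⁻¹ ∑ χ, (bijFourier χ)³` tends to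
`exp (-1/2)`. As `n` is odd, the elements of `G` sum to zero and `bijFourier` does not change when
all entries of `χ` are multiplied by one character. Hence the tuples in which some character occurs
at least `n - n / 256` times contribute `n` times the sum over *sparse* tuples, those with at most
`n / 256` nontrivial entries, and all other tuples are *spread*.

**Sparse tuples.** If `χ j ≠ 1`, then `χ j` sums to zero over `G`, so replacing `e j` by `e i` in
the average and summing over `i` gives a linear recursion (`bijFourier_recursion`): up to the factor
`-1 / (n - m + 1)`, the coefficient of a tuple with `m` nontrivial entries is the sum of the
coefficients of the tuples obtained by merging the entry `j` into another one. Since at most half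
of the entries can be inverse to a well chosen `χ j` (here `n` odd is used again), this yields a sup
bound of the size `√(m! (4/5)^m / n^m)`. The same recursion for second moments over all tuples with
a given support yields `√(m! (6/5)^m / n^m)`. The product of the two, summed over the
`n.choose m` supports, is at most `(24/25)^(m/2)` (`norm_sparseCubeSum_le`): a summable bound
independent of `n`. For fixed `m`, only those merges matter in which two mutually inverse characters
cancel, and the limit `b m` of the cubic sum over the tuples with `m` nontrivial entries satisfies
`b (m + 2) = -b m / (m + 2)`, `b 0 = 1` and `b 1 = 0` (`sparseCubeSum_limit`), so
`∑ b m = ∑ (-1/2)^k / k! = exp (-1/2)`. Dominated convergence over `m` finishes this part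
(`uniform_sum_limit`).

**Spread tuples.** If the character `r` occurs `a r` times in `χ`, then `n! * bijFourier χ` is
`∏ (a r)!` times the coefficient of `∏ z r ^ a r` in `∏ g, ∑ r, z r * r g`. On the torus
`|z r| = √(a r / n)` this polynomial is bounded by `1`, by Parseval and the inequality of
arithmetic and geometric means, which gives `norm_bijFourier_mul_le`. There are `n! / ∏ (a r)!`
tuples with the same occurrence numbers, and the resulting sum over `a` is bounded by a product of
one-variable sums after an exponential tilt (`sum_spreadTuples_le`). The outcome is a power of `n`
times `exp (K √n)` times an exponentially small factor.
-/

namespace AdditiveTriples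

open Finset Function Filter Topology
open scoped Classical ComplexConjugate

noncomputable section

/-! ### Fourier coefficients of the set of bijections -/

section Basic

variable {ι G : Type*} [Fintype ι] [AddCommGroup G]

/-- The set of indices at which the tuple `χ` has a nontrivial character. -/
def charSupport (χ : ι → AddChar G ℂ) : Finset ι := univ.filter fun i => χ i ≠ 1

@[simp] lemma mem_charSupport {χ : ι → AddChar G ℂ} {i : ι} : i ∈ charSupport χ ↔ χ i ≠ 1 := by
  simp [charSupport]

variable [Fintype G]

/-- The normalised Fourier coefficient at `χ` of the set of bijections: the average of
`∏ i, χ i (e i)` over all bijections `e : ι ≃ G`. The normalisation by `(card ι)!` is the number of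
bijections only when `ι` and `G` have the same cardinality, the only case of interest. -/
def bijFourier (χ : ι → AddChar G ℂ) : ℂ :=
  (∑ e : ι ≃ G, ∏ i, χ i (e i)) / (Fintype.card ι).factorial

/-- The tuples of characters whose set of nontrivial entries is exactly `A`. -/
def withSupport (G : Type*) [AddCommGroup G] [Fintype G] (A : Finset ι) :
    Finset (ι → AddChar G ℂ) := univ.filter fun χ => charSupport χ = A

@[simp] lemma mem_withSupport {A : Finset ι} {χ : ι → AddChar G ℂ} :
    χ ∈ withSupport G A ↔ charSupport χ = A := by
  simp [withSupport]

/-- The tuple obtained from `χ` by multiplying the entry at `i` by the one at `j` and making the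
entry at `j` trivial. -/
def merge (χ : ι → AddChar G ℂ) (i j : ι) : ι → AddChar G ℂ :=
  update (update χ i (χ i * χ j)) j 1

lemma bijFourier_one (hc : Fintype.card ι = Fintype.card G) :
    bijFourier (1 : ι → AddChar G ℂ) = 1 := by
  have e : ι ≃ G := Fintype.equivOfCardEq hc
  simp [bijFourier, Fintype.card_equiv e, Nat.factorial_ne_zero]

lemma bijFourier_comp_perm (χ : ι → AddChar G ℂ) (σ : Equiv.Perm ι) :
    bijFourier (χ ∘ σ) = bijFourier χ := by
  unfold bijFourier
  congr 1
  refine Fintype.sum_equiv (Equiv.equivCongr σ (Equiv.refl G)) _ _ fun e => ?_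
  refine Fintype.prod_equiv σ _ _ fun i => ?_
  simp

lemma sum_eq_zero_of_odd (hodd : Odd (Fintype.card G)) : ∑ g : G, g = 0 := by
  have h : ∑ g : G, g = -∑ g : G, g := by
    rw [← Finset.sum_neg_distrib]
    exact (Fintype.sum_equiv (Equiv.neg G) _ _ fun g => by simp)
  have h2 : (2 : ℕ) • ∑ g : G, g = 0 := by
    rw [two_nsmul]; nth_rewrite 1 [h]; simp
  have h3 : addOrderOf (∑ g : G, g) ∣ 2 := addOrderOf_dvd_iff_nsmul_eq_zero.2 h2
  have h4 : addOrderOf (∑ g : G, g) ∣ Fintype.card G := addOrderOf_dvd_card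
  have h5 : addOrderOf (∑ g : G, g) ∣ 1 := by
    have := Nat.dvd_gcd h3 h4
    rwa [(Nat.coprime_two_left.2 hodd)] at this
  exact AddMonoid.addOrderOf_eq_one_iff.1 (Nat.dvd_one.1 h5)

lemma addChar_map_sum {κ A : Type*} [AddCommMonoid A] (ρ : AddChar A ℂ) (s : Finset κ) (f : κ → A) :
    ρ (∑ i ∈ s, f i) = ∏ i ∈ s, ρ (f i) := by
  induction s using Finset.induction_on with
  | empty => simp
  | insert a s ha ih => rw [sum_insert ha, prod_insert ha, AddChar.map_add_eq_mul, ih]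

lemma bijFourier_const_mul (hodd : Odd (Fintype.card G)) (ρ : AddChar G ℂ)
    (χ : ι → AddChar G ℂ) : bijFourier (fun i => ρ * χ i) = bijFourier χ := by
  unfold bijFourier
  congr 1
  refine Finset.sum_congr rfl fun e _ => ?_
  have : ∏ i, ρ (e i) = 1 := by
    rw [← addChar_map_sum, Equiv.sum_comp e (fun g => g), sum_eq_zero_of_odd hodd]
    simp
  simp [Finset.prod_mul_distrib, this]

/-- Replace `e j` by `e i` in the argument of `χ j` and sum over all `i`: the total vanishes because
`χ j` is nontrivial, and the term `i` is the coefficient of the merged tuple. -/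
lemma bijFourier_add_sum_merge {χ : ι → AddChar G ℂ} {j : ι} (hj : χ j ≠ 1) :
    bijFourier χ + ∑ i ∈ univ.erase j, bijFourier (merge χ i j) = 0 := by
  have key : ∀ i, i ≠ j → ∀ e : ι ≃ G, ∏ k, merge χ i j k (e k) =
      (∏ k ∈ univ.erase j, χ k (e k)) * χ j (e i) := by
    intro i hij e
    rw [← Finset.mul_prod_erase univ _ (mem_univ j),
      ← Finset.mul_prod_erase (univ.erase j) _ (mem_erase.2 ⟨hij, mem_univ i⟩),
      ← Finset.mul_prod_erase (univ.erase j) (fun k => χ k (e k)) (mem_erase.2 ⟨hij, mem_univ i⟩)]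
    have : ∏ k ∈ (univ.erase j).erase i, merge χ i j k (e k) =
        ∏ k ∈ (univ.erase j).erase i, χ k (e k) := by
      refine Finset.prod_congr rfl fun k hk => ?_
      simp only [mem_erase, mem_univ, and_true] at hk
      simp [merge, update_of_ne hk.1, update_of_ne hk.2]
    rw [this]
    simp [merge, update_of_ne hij]
    ring
  have key0 : ∀ e : ι ≃ G, ∏ k, χ k (e k) = (∏ k ∈ univ.erase j, χ k (e k)) * χ j (e j) := by
    intro e
    rw [← Finset.mul_prod_erase univ _ (mem_univ j), mul_comm]
  have hsum : ∀ e : ι ≃ G, ∑ i, (∏ k ∈ univ.erase j, χ k (e k)) * χ j (e i) = 0 := by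
    intro e
    rw [← Finset.mul_sum, Equiv.sum_comp e (fun g => χ j g),
      AddChar.sum_eq_zero_iff_ne_zero.2 hj, mul_zero]
  unfold bijFourier
  rw [← Finset.sum_div, ← add_div, Finset.sum_comm, ← Finset.sum_add_distrib]
  rw [Finset.sum_eq_zero, zero_div]
  intro e _
  rw [← hsum e, ← Finset.add_sum_erase univ _ (mem_univ j), key0]
  congr 1
  exact Finset.sum_congr rfl fun i hi => key i (mem_erase.1 hi).1 e

/-- Merging into a trivial entry only permutes the entries. -/
lemma bijFourier_merge_of_eq_one {χ : ι → AddChar G ℂ} {i j : ι} (hi : χ i = 1) :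
    bijFourier (merge χ i j) = bijFourier χ := by
  rw [← bijFourier_comp_perm χ (Equiv.swap i j)]
  congr 1
  funext k
  by_cases hkj : k = j
  · subst hkj; simp [merge, hi]
  by_cases hki : k = i
  · subst hki; simp [merge, hi, hkj]
  · simp [merge, hkj, hki, Equiv.swap_apply_of_ne_of_ne hki hkj]

lemma bijFourier_recursion {χ : ι → AddChar G ℂ} {A : Finset ι} (hA : charSupport χ = A) {j : ι}
    (hj : j ∈ A) :
    ((Fintype.card ι - A.card + 1 : ℕ) : ℂ) * bijFourier χ =
      -∑ i ∈ A.erase j, bijFourier (merge χ i j) := by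
  subst hA
  have h := bijFourier_add_sum_merge (mem_charSupport.1 hj)
  have hsub : (charSupport χ).erase j ⊆ univ.erase j := erase_subset_erase _ (subset_univ _)
  rw [← Finset.sum_sdiff hsub] at h
  have h2 : ∑ i ∈ univ.erase j \ (charSupport χ).erase j, bijFourier (merge χ i j) =
      ((Fintype.card ι - (charSupport χ).card : ℕ) : ℂ) * bijFourier χ := by
    rw [Finset.sum_congr rfl (g := fun _ => bijFourier χ)]
    · rw [Finset.sum_const, nsmul_eq_mul, card_sdiff_of_subset hsub, card_erase_of_mem (mem_univ j),
        card_erase_of_mem hj, card_univ]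
      have := Finset.card_pos.2 ⟨j, hj⟩
      congr 2
      omega
    · intro i hi
      refine bijFourier_merge_of_eq_one ?_
      simp at hi
      by_contra h
      exact h (hi.2 hi.1)
  rw [h2] at h
  push_cast
  linear_combination h

/-- Summing over all ways of writing `ψ` as a product of the entries at `i` and `j` forces
`e i = e j`, which no bijection satisfies. -/
lemma sum_bijFourier_update_eq_zero {η : ι → AddChar G ℂ} {i j : ι} (hij : i ≠ j)
    (ψ : AddChar G ℂ) :
    ∑ s : AddChar G ℂ, bijFourier (update (update η i s) j (ψ * s⁻¹)) = 0 := by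
  unfold bijFourier
  rw [← Finset.sum_div, Finset.sum_comm, Finset.sum_eq_zero, zero_div]
  intro e _
  have hji : j ∈ univ.erase i := mem_erase.2 ⟨hij.symm, mem_univ j⟩
  have key : ∀ s : AddChar G ℂ, ∏ k, update (update η i s) j (ψ * s⁻¹) k (e k) =
      s (e i - e j) * (ψ (e j) * ∏ k ∈ (univ.erase i).erase j, η k (e k)) := by
    intro s
    rw [← Finset.mul_prod_erase univ _ (mem_univ i), ← Finset.mul_prod_erase _ _ hji]
    have : ∏ k ∈ (univ.erase i).erase j, update (update η i s) j (ψ * s⁻¹) k (e k) =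
        ∏ k ∈ (univ.erase i).erase j, η k (e k) := by
      refine Finset.prod_congr rfl fun k hk => ?_
      simp only [mem_erase, mem_univ, and_true] at hk
      simp [update_of_ne hk.1, update_of_ne hk.2]
    rw [this]
    simp [update_of_ne hij, sub_eq_add_neg, AddChar.map_add_eq_mul]
    ring
  simp_rw [key]
  rw [← Finset.sum_mul, AddChar.sum_apply_eq_zero_iff_ne_zero.2, zero_mul]
  rw [sub_ne_zero]
  exact fun h => hij (e.injective h)

/-- A tuple with support `insert j B` is a tuple with support `B` together with a nontrivial
character at `j`. -/
lemma sum_withSupport_insert {M : Type*} [AddCommMonoid M] {B : Finset ι} {j : ι} (hj : j ∉ B)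
    (h : (ι → AddChar G ℂ) → M) :
    ∑ χ ∈ withSupport G (insert j B), h χ =
      ∑ η ∈ withSupport G B, ∑ t ∈ univ.erase 1, h (update η j t) := by
  rw [← Finset.sum_product']
  refine Finset.sum_bij' (fun χ _ => (update χ j 1, χ j)) (fun p _ => update p.1 j p.2)
    ?_ ?_ ?_ ?_ ?_
  · intro χ hχ
    rw [mem_withSupport] at hχ
    simp only [mem_product, mem_withSupport, mem_erase, mem_univ, and_true]
    constructor
    · ext k
      by_cases hk : k = j
      · subst hk; simp [hj]
      · have := Finset.ext_iff.1 hχ k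
        simp [hk] at this
        simp [hk, this]
    · have := Finset.ext_iff.1 hχ j
      simpa using this
  · rintro ⟨η, t⟩ hp
    simp only [mem_product, mem_withSupport, mem_erase, mem_univ, and_true] at hp
    rw [mem_withSupport]
    ext k
    by_cases hk : k = j
    · subst hk; simp [hp.2]
    · have := Finset.ext_iff.1 hp.1 k
      simp at this
      simp [hk, this]
  · intro χ _; simp
  · rintro ⟨η, t⟩ hp
    simp only [mem_product, mem_withSupport, mem_erase, mem_univ, and_true] at hp
    have : η j = 1 := by
      by_contra h
      exact hj (hp.1 ▸ mem_charSupport.2 h)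
    simp [← this]
  · intro χ _; simp

end Basic

/-! ### Second moments and sup bounds on sparse tuples -/

section Bounds

variable {ι G : Type*} [AddCommGroup G]

/-- In the application, `g s t` is the Fourier coefficient with the characters `s` and `t` at two
given indices. The sum without the restrictions `s ≠ 1` and `t ≠ 1` vanishes, so inclusion–exclusion
evaluates the restricted sum. -/
lemma sum_mul_conj_of_sum_eq_zero {D : Type*} [CommGroup D] [Fintype D] (g : D → D → ℂ)
    (h0 : ∀ ψ, ∑ s, g s (ψ * s⁻¹) = 0) (hsymm : ∀ ψ, g 1 ψ = g ψ 1) :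
    ∑ s ∈ univ.erase 1, ∑ t ∈ univ.erase 1, g (s * t) 1 * conj (g s t) =
      -(2 * ∑ ψ ∈ univ.erase 1, ((‖g ψ 1‖ ^ 2 : ℝ) : ℂ) + ((‖g 1 1‖ ^ 2 : ℝ) : ℂ)) := by
  have hn : ∀ z : ℂ, ((‖z‖ ^ 2 : ℝ) : ℂ) = z * conj z := by
    intro z; rw [Complex.mul_conj, Complex.normSq_eq_norm_sq]
  have hfull : ∑ s, ∑ t, g (s * t) 1 * conj (g s t) = 0 := by
    have : ∀ s, ∑ t, g (s * t) 1 * conj (g s t) = ∑ ψ, g ψ 1 * conj (g s (ψ * s⁻¹)) := by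
      intro s
      refine Fintype.sum_equiv (Equiv.mulLeft s) _ _ fun t => ?_
      simp
    simp_rw [this]
    rw [Finset.sum_comm, Finset.sum_eq_zero]
    intro ψ _
    rw [← Finset.mul_sum, ← map_sum, h0]
    simp
  rw [← Finset.add_sum_erase univ _ (mem_univ (1 : D))] at hfull
  have h1 : ∀ s : D, ∑ t, g (s * t) 1 * conj (g s t) =
      g s 1 * conj (g s 1) + ∑ t ∈ univ.erase 1, g (s * t) 1 * conj (g s t) := by
    intro s
    rw [← Finset.add_sum_erase univ _ (mem_univ (1 : D)), mul_one]
  simp_rw [h1] at hfull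
  rw [Finset.sum_add_distrib] at hfull
  simp_rw [one_mul, hsymm] at hfull
  simp_rw [hn]
  linear_combination hfull

lemma merge_update_update {η : ι → AddChar G ℂ} {i j : ι} (hij : i ≠ j) (hj : η j = 1)
    (s t : AddChar G ℂ) : merge (update (update η i s) j t) i j = update η i (s * t) := by
  ext1 k
  by_cases hk : k = j
  · subst hk; simp [merge, hij.symm, hj]
  by_cases hk' : k = i
  · subst hk'; simp [merge, hk]
  · simp [merge, hk, hk']

lemma update_update_one {η : ι → AddChar G ℂ} {i j : ι} (hij : i ≠ j) (hj : η j = 1)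
    (s : AddChar G ℂ) : update (update η i s) j 1 = update η i s := by
  rw [update_eq_self_iff, update_of_ne hij.symm, hj]

variable [Fintype ι]

lemma charSupport_merge_of_mul_ne_one {χ : ι → AddChar G ℂ} {i j : ι} (hij : i ≠ j)
    (hi : χ i ≠ 1) (h : χ i * χ j ≠ 1) :
    charSupport (merge χ i j) = (charSupport χ).erase j := by
  ext k
  by_cases hk : k = j
  · subst hk; simp [merge]
  by_cases hk' : k = i
  · subst hk'; simp [merge, hk, hi, h]
  · simp [merge, hk, hk']

lemma charSupport_merge_of_mul_eq_one {χ : ι → AddChar G ℂ} {i j : ι} (h : χ i * χ j = 1) :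
    charSupport (merge χ i j) = ((charSupport χ).erase j).erase i := by
  ext k
  by_cases hk : k = j
  · subst hk; simp [merge]
  by_cases hk' : k = i
  · subst hk'; simp [merge, hk, h]
  · simp [merge, hk, hk']

variable [Fintype G]

/-- The second moment of the Fourier coefficients over the tuples with support `A`. -/
def supportEnergy (G : Type*) [AddCommGroup G] [Fintype G] (A : Finset ι) : ℝ :=
  ∑ χ ∈ withSupport G A, ‖bijFourier χ‖ ^ 2

lemma supportEnergy_nonneg (A : Finset ι) : 0 ≤ supportEnergy G A :=
  Finset.sum_nonneg fun _ _ => by positivity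

lemma eq_one_of_notMem_support {η : ι → AddChar G ℂ} {B : Finset ι} (h : η ∈ withSupport G B)
    {j : ι} (hj : j ∉ B) : η j = 1 := by
  by_contra h'
  exact hj (mem_withSupport.1 h ▸ mem_charSupport.2 h')

lemma sum_merge_mul_conj {C : Finset ι} {i j : ι} (hij : i ≠ j) (hi : i ∉ C) (hj : j ∉ C) :
    ∑ χ ∈ withSupport G (insert j (insert i C)), bijFourier (merge χ i j) * conj (bijFourier χ) =
      -(2 * (supportEnergy G (insert i C) : ℂ) + (supportEnergy G C : ℂ)) := by
  rw [sum_withSupport_insert (by simp [hij.symm, hj]), sum_withSupport_insert hi]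
  unfold supportEnergy
  rw [sum_withSupport_insert hi]
  push_cast
  rw [Finset.mul_sum, ← Finset.sum_add_distrib, ← Finset.sum_neg_distrib]
  refine Finset.sum_congr rfl fun η hη => ?_
  have hηj := eq_one_of_notMem_support hη hj
  have hηi := eq_one_of_notMem_support hη hi
  have := sum_mul_conj_of_sum_eq_zero
    (fun s t => bijFourier (update (update η i s) j t)) (sum_bijFourier_update_eq_zero hij)
    (fun ψ => by
      rw [← bijFourier_comp_perm _ (Equiv.swap i j)]
      congr 1
      funext k
      by_cases hk : k = j
      · subst hk; simp [hij]
      by_cases hk' : k = i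
      · subst hk'; simp [hk]
      · simp [hk, hk', Equiv.swap_apply_of_ne_of_ne hk' hk])
  simp only [update_update_one hij hηj] at this
  rw [show update η i 1 = η by rw [update_eq_self_iff, hηi]] at this
  simp_rw [merge_update_update hij hηj]
  rw [this]
  push_cast
  rfl

/-- The pointwise recursion, multiplied by the conjugate coefficient and summed over all tuples with
support `A`, closes up on second moments over smaller supports. -/
lemma supportEnergy_recursion {A : Finset ι} {j : ι} (hj : j ∈ A) :
    ((Fintype.card ι - A.card + 1 : ℕ) : ℝ) * supportEnergy G A =
      ∑ i ∈ A.erase j, (2 * supportEnergy G (A.erase j) +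
        supportEnergy G ((A.erase j).erase i)) := by
  have h : (((Fintype.card ι - A.card + 1 : ℕ) : ℝ) * supportEnergy G A : ℂ) =
      ∑ i ∈ A.erase j, (2 * (supportEnergy G (A.erase j) : ℂ) +
        (supportEnergy G ((A.erase j).erase i) : ℂ)) := by
    have h1 : (supportEnergy G A : ℂ) =
        ∑ χ ∈ withSupport G A, bijFourier χ * conj (bijFourier χ) := by
      unfold supportEnergy
      push_cast
      refine Finset.sum_congr rfl fun χ _ => ?_
      rw [Complex.mul_conj, Complex.normSq_eq_norm_sq]; push_cast; rfl
    rw [h1, Finset.mul_sum]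
    have h2 : ∀ χ ∈ withSupport G A, (((Fintype.card ι - A.card + 1 : ℕ) : ℝ) : ℂ) *
        (bijFourier χ * conj (bijFourier χ)) =
        ∑ i ∈ A.erase j, -(bijFourier (merge χ i j) * conj (bijFourier χ)) := by
      intro χ hχ
      rw [← mul_assoc, Complex.ofReal_natCast, bijFourier_recursion (mem_withSupport.1 hχ) hj,
        neg_mul, Finset.sum_mul, Finset.sum_neg_distrib]
    rw [Finset.sum_congr rfl h2, Finset.sum_comm]
    refine Finset.sum_congr rfl fun i hi => ?_
    have hA : A = insert j (insert i ((A.erase j).erase i)) := by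
      rw [insert_erase hi, insert_erase hj]
    rw [Finset.sum_neg_distrib]
    conv_lhs => rw [hA]
    rw [sum_merge_mul_conj (mem_erase.1 hi).1 (by simp) (by simp), neg_neg, insert_erase hi]
  exact_mod_cast h

/-- The quantity `√(m! (b / n) ^ m)`, which bounds sup norms (for `b = 4/5`) and second moments (for
`b = 6/5`) over supports of size `m`. The argument only needs that `b` is large enough for the
recursions in each case and that the product of the two values is less than `1`. -/
def decayBound (b : ℝ) (n m : ℕ) : ℝ := √((m.factorial : ℝ) * (b / n) ^ m)

lemma decayBound_nonneg (b : ℝ) (n m : ℕ) : 0 ≤ decayBound b n m := Real.sqrt_nonneg _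

@[simp] lemma decayBound_zero (b : ℝ) (n : ℕ) : decayBound b n 0 = 1 := by simp [decayBound]

lemma decayBound_succ {b : ℝ} (hb : 0 ≤ b) (n m : ℕ) :
    decayBound b n (m + 1) = √((m + 1) * (b / n)) * decayBound b n m := by
  unfold decayBound
  rw [← Real.sqrt_mul (by positivity), Nat.factorial_succ]
  congr 1
  push_cast
  ring

lemma mul_decayBound_succ_le {b : ℝ} (hb : 4 / 5 ≤ b) {n m : ℕ} (h : 256 * (m + 2) ≤ n) :
    (m + 1) * decayBound b n (m + 1) ≤ 7 / 100 * n * decayBound b n (m + 2) := by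
  have hn : (256 : ℝ) * (m + 2) ≤ n := by exact_mod_cast h
  have hn0 : (0 : ℝ) < n := by linarith [(Nat.cast_nonneg m : (0 : ℝ) ≤ m)]
  rw [decayBound_succ (by linarith) n (m + 1), ← mul_assoc]
  refine mul_le_mul_of_nonneg_right ?_ (decayBound_nonneg _ _ _)
  have : (m + 1 : ℝ) / (7 / 100 * n) ≤ √((((m + 1 : ℕ) : ℝ) + 1) * (b / n)) := by
    apply Real.le_sqrt_of_sq_le
    rw [div_pow, div_le_iff₀ (by positivity)]
    have e : (((m + 1 : ℕ) : ℝ) + 1) * (b / n) * (7 / 100 * n) ^ 2 =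
        (m + 2) * b * (49 / 10000) * n := by
      push_cast; field_simp; ring
    rw [e]
    have hm : (0 : ℝ) ≤ m := Nat.cast_nonneg m
    calc (m + 1 : ℝ) ^ 2 ≤ (m + 2) * (4 / 5) * (49 / 10000) * (256 * (m + 2)) := by nlinarith
      _ ≤ (m + 2) * b * (49 / 10000) * n := by gcongr
  rw [div_le_iff₀ (by positivity)] at this
  linarith

lemma mul_decayBound_le {b c x : ℝ} (hb : 0 < b) (hc : 0 ≤ c) {n m : ℕ} (hn : 0 < n)
    (h : x ^ 2 ≤ c ^ 2 * b ^ 2 * ((m + 1) * (m + 2))) :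
    x * decayBound b n m ≤ c * n * decayBound b n (m + 2) := by
  have hn0 : (0 : ℝ) < n := by exact_mod_cast hn
  rw [decayBound_succ hb.le n (m + 1), decayBound_succ hb.le n m, ← mul_assoc, ← mul_assoc]
  refine mul_le_mul_of_nonneg_right ?_ (decayBound_nonneg _ _ _)
  rw [mul_assoc, ← Real.sqrt_mul (by positivity)]
  have e : √((((m + 1 : ℕ) : ℝ) + 1) * (b / n) * ((m + 1) * (b / n))) =
      b / n * √((m + 1) * (m + 2)) := by
    rw [show (((m + 1 : ℕ) : ℝ) + 1) * (b / n) * ((m + 1) * (b / n)) =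
      (b / n) ^ 2 * ((m + 1) * (m + 2)) by push_cast; ring,
      Real.sqrt_mul (by positivity), Real.sqrt_sq (by positivity)]
  rw [e, show c * n * (b / n * √((m + 1) * (m + 2) : ℝ)) = c * b * √((m + 1) * (m + 2) : ℝ) by
    field_simp]
  refine le_trans (Real.le_sqrt_of_sq_le h) ?_
  rw [Real.sqrt_mul (by positivity), ← mul_pow, Real.sqrt_sq (by positivity)]

lemma withSupport_empty : withSupport G (∅ : Finset ι) = {1} := by
  ext χ
  simp only [mem_withSupport, mem_singleton, Finset.ext_iff, mem_charSupport, notMem_empty,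
    iff_false, not_not]
  exact funext_iff.symm

lemma bijFourier_eq_zero_of_card_one {χ : ι → AddChar G ℂ} (h : (charSupport χ).card = 1) :
    bijFourier χ = 0 := by
  obtain ⟨j, hj⟩ := Finset.card_eq_one.1 h
  have := bijFourier_recursion hj (mem_singleton_self j)
  simp only [erase_singleton, sum_empty, neg_zero, mul_eq_zero] at this
  exact this.resolve_left (Nat.cast_ne_zero.2 (Nat.succ_ne_zero _))

lemma card_sub_lower {n k : ℕ} (h : 256 * (k + 2) ≤ n) :
    99 / 100 * (n : ℝ) ≤ ((n - (k + 2) + 1 : ℕ) : ℝ) := by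
  have h1 : (256 : ℝ) * (k + 2) ≤ n := by exact_mod_cast h
  rw [Nat.cast_add, Nat.cast_sub (by omega)]
  push_cast
  linarith

lemma supportEnergy_le (hc : Fintype.card ι = Fintype.card G) (m : ℕ) :
    ∀ A : Finset ι, A.card = m → 256 * m ≤ Fintype.card ι →
      supportEnergy G A ≤ decayBound (6 / 5) (Fintype.card ι) m := by
  induction m using Nat.twoStepInduction with
  | zero =>
    intro A hA _
    rw [Finset.card_eq_zero.1 hA, supportEnergy, withSupport_empty]
    simp [bijFourier_one hc]
  | one =>
    intro A hA _
    have : supportEnergy G A = 0 := by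
      refine Finset.sum_eq_zero fun χ hχ => ?_
      rw [mem_withSupport] at hχ
      rw [bijFourier_eq_zero_of_card_one (by rw [hχ, hA])]
      simp
    rw [this]; exact decayBound_nonneg _ _ _
  | more k ih0 ih1 =>
    intro A hA hn
    obtain ⟨j, hj⟩ : A.Nonempty := Finset.card_pos.1 (by omega)
    have hrec := supportEnergy_recursion (G := G) hj
    rw [hA] at hrec
    set n := Fintype.card ι
    have h1 : ∑ i ∈ A.erase j, (2 * supportEnergy G (A.erase j) +
        supportEnergy G ((A.erase j).erase i)) ≤
        ∑ i ∈ A.erase j, (2 * decayBound (6 / 5) n (k + 1) + decayBound (6 / 5) n k) := by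
      refine Finset.sum_le_sum fun i hi => ?_
      have := ih1 (A.erase j) (by rw [card_erase_of_mem hj, hA]; rfl) (by omega)
      have := ih0 ((A.erase j).erase i)
        (by rw [card_erase_of_mem hi, card_erase_of_mem hj, hA]; rfl) (by omega)
      linarith
    rw [Finset.sum_const, card_erase_of_mem hj, hA, nsmul_eq_mul, ← hrec,
      show k + 1 + 1 - 1 = k + 1 by omega] at h1
    have h2 := mul_decayBound_succ_le (b := 6 / 5) (by norm_num) (m := k) (n := n) (by omega)
    have h3 := mul_decayBound_le (b := 6 / 5) (c := 84 / 100) (x := k + 1) (by norm_num)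
      (by norm_num) (m := k) (n := n) (by omega) (by nlinarith [(Nat.cast_nonneg k : (0 : ℝ) ≤ k)])
    have h4 := card_sub_lower (n := n) (k := k) (by omega)
    have hn0 : (0 : ℝ) < n := by exact_mod_cast (by omega : 0 < n)
    push_cast at h1
    have h5 : ((n - (k + 2) + 1 : ℕ) : ℝ) * supportEnergy G A ≤
        99 / 100 * n * decayBound (6 / 5) n (k + 2) := by
      have := mul_nonneg hn0.le (decayBound_nonneg (6 / 5) n (k + 2))
      have e : ((n - (k + 2) + 1 : ℕ) : ℝ) = ((n - (k + 1 + 1) : ℕ) : ℝ) + 1 := by push_cast; rfl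
      rw [e]
      linarith
    have h6 : 99 / 100 * (n : ℝ) * supportEnergy G A ≤
        99 / 100 * n * decayBound (6 / 5) n (k + 2) :=
      le_trans (mul_le_mul_of_nonneg_right h4 (supportEnergy_nonneg A)) h5
    exact le_of_mul_le_mul_left h6 (by positivity)

/-- The classes of `χ j` and its inverse are disjoint because `G` has odd order, so the smaller one
contains at most half of the support. -/
lemma exists_few_inverses (hodd : Odd (Fintype.card G)) {χ : ι → AddChar G ℂ} {A : Finset ι}
    (hA : charSupport χ = A) (hne : A.Nonempty) :
    ∃ j ∈ A, 2 * (A.filter fun i => χ i * χ j = 1).card ≤ A.card := by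
  obtain ⟨j, hj⟩ := hne
  by_cases h : 2 * (A.filter fun i => χ i * χ j = 1).card ≤ A.card
  · exact ⟨j, hj, h⟩
  push Not at h
  obtain ⟨l, hl⟩ : (A.filter fun i => χ i * χ j = 1).Nonempty := Finset.card_pos.1 (by omega)
  simp only [mem_filter] at hl
  refine ⟨l, hl.1, ?_⟩
  have hdisj : Disjoint (A.filter fun i => χ i * χ j = 1) (A.filter fun i => χ i * χ l = 1) := by
    rw [Finset.disjoint_filter]
    intro i _ h1 h2
    have hjl : χ j = χ l := mul_left_cancel (h1.trans h2.symm)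
    have hsq : χ j ^ 2 = 1 := by rw [pow_two]; nth_rewrite 1 [hjl]; exact hl.2
    have h3 : orderOf (χ j) ∣ 2 := orderOf_dvd_of_pow_eq_one hsq
    have h4 : orderOf (χ j) ∣ Fintype.card (AddChar G ℂ) := orderOf_dvd_card
    rw [AddChar.card_eq] at h4
    have h5 := Nat.dvd_gcd h3 h4
    rw [Nat.coprime_two_left.2 hodd] at h5
    have : χ j = 1 := orderOf_eq_one_iff.1 (Nat.dvd_one.1 h5)
    rw [← hA] at hj
    exact mem_charSupport.1 hj this
  have := Finset.card_union_of_disjoint hdisj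
  have h2 : ((A.filter fun i => χ i * χ j = 1) ∪ (A.filter fun i => χ i * χ l = 1)).card ≤ A.card :=
    Finset.card_le_card (Finset.union_subset (filter_subset _ _) (filter_subset _ _))
  omega

/-- The gain over the trivial count comes from choosing the index `j` in the recursion so that at
most half of the other entries are inverse to `χ j`; this is what makes `4/5 < 1` possible. -/
lemma norm_bijFourier_le (hc : Fintype.card ι = Fintype.card G) (hodd : Odd (Fintype.card G))
    (m : ℕ) : ∀ χ : ι → AddChar G ℂ, (charSupport χ).card = m → 256 * m ≤ Fintype.card ι →
      ‖bijFourier χ‖ ≤ decayBound (4 / 5) (Fintype.card ι) m := by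
  induction m using Nat.twoStepInduction with
  | zero =>
    intro χ hχ _
    have : χ ∈ withSupport G ∅ := mem_withSupport.2 (Finset.card_eq_zero.1 hχ)
    rw [withSupport_empty, mem_singleton] at this
    simp [this, bijFourier_one hc]
  | one =>
    intro χ hχ _
    rw [bijFourier_eq_zero_of_card_one hχ, norm_zero]
    exact decayBound_nonneg _ _ _
  | more k ih0 ih1 =>
    intro χ hχ hn
    obtain ⟨j, hj, hcount⟩ := exists_few_inverses hodd rfl
      (Finset.card_pos.1 (show 0 < (charSupport χ).card by omega))
    set A := charSupport χ with hA
    have hrec := congrArg norm (bijFourier_recursion hA.symm hj)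
    rw [norm_mul, norm_neg, Complex.norm_natCast, hχ] at hrec
    set n := Fintype.card ι
    have h0 := decayBound_nonneg (4 / 5) n k
    have h0' := decayBound_nonneg (4 / 5) n (k + 1)
    have h1 : ‖∑ i ∈ A.erase j, bijFourier (merge χ i j)‖ ≤
        ∑ i ∈ A.erase j, ((if χ i * χ j = 1 then decayBound (4 / 5) n k else 0) +
          decayBound (4 / 5) n (k + 1)) := by
      refine (norm_sum_le _ _).trans (Finset.sum_le_sum fun i hi => ?_)
      have hij := (mem_erase.1 hi).1
      have hiA := (mem_erase.1 hi).2
      split_ifs with h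
      · have := ih0 (merge χ i j) (by
          rw [charSupport_merge_of_mul_eq_one h, card_erase_of_mem hi, card_erase_of_mem hj, hχ]
          rfl)
          (by omega)
        linarith
      · have := ih1 (merge χ i j) (by
          rw [charSupport_merge_of_mul_ne_one hij (mem_charSupport.1 hiA) h,
            card_erase_of_mem hj, hχ]; rfl)
          (by omega)
        linarith
    have h2 : ∑ i ∈ A.erase j, ((if χ i * χ j = 1 then decayBound (4 / 5) n k else 0) +
          decayBound (4 / 5) n (k + 1)) ≤
        (k + 2) / 2 * decayBound (4 / 5) n k + (k + 1) * decayBound (4 / 5) n (k + 1) := by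
      rw [Finset.sum_add_distrib, ← Finset.sum_filter, Finset.sum_const, Finset.sum_const,
        nsmul_eq_mul, nsmul_eq_mul, card_erase_of_mem hj, hχ]
      have h3 : (((A.erase j).filter fun i => χ i * χ j = 1).card : ℝ) ≤ (k + 2) / 2 := by
        have : ((A.erase j).filter fun i => χ i * χ j = 1).card ≤
            (A.filter fun i => χ i * χ j = 1).card :=
          Finset.card_le_card (filter_subset_filter _ (erase_subset _ _))
        rw [le_div_iff₀ (by norm_num)]
        exact_mod_cast (by omega :
          ((A.erase j).filter fun i => χ i * χ j = 1).card * 2 ≤ k + 2)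
      have e : ((k + 1 + 1 - 1 : ℕ) : ℝ) = k + 1 := by push_cast; ring
      rw [e]
      gcongr
    have h3 := mul_decayBound_succ_le (b := 4 / 5) (by norm_num) (m := k) (n := n) (by omega)
    have h4 := mul_decayBound_le (b := 4 / 5) (c := 89 / 100) (x := (k + 2) / 2) (by norm_num)
      (by norm_num) (m := k) (n := n) (by omega) (by nlinarith [(Nat.cast_nonneg k : (0 : ℝ) ≤ k)])
    have h5 := card_sub_lower (n := n) (k := k) (by omega)
    have hn0 : (0 : ℝ) < n := by exact_mod_cast (by omega : 0 < n)
    have h6 : 99 / 100 * (n : ℝ) * ‖bijFourier χ‖ ≤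
        99 / 100 * n * decayBound (4 / 5) n (k + 2) := by
      have := mul_nonneg hn0.le (decayBound_nonneg (4 / 5) n (k + 2))
      have := mul_le_mul_of_nonneg_right h5 (norm_nonneg (bijFourier χ))
      have e : ((n - (k + 2) + 1 : ℕ) : ℝ) = ((n - (k + 1 + 1) + 1 : ℕ) : ℝ) := rfl
      rw [e] at this
      linarith
    exact le_of_mul_le_mul_left h6 (by positivity)

end Bounds

/-! ### Cubic sums over tuples with given support -/

section CubeInequalities

lemma norm_cube_add_cube_le (a b : ℂ) :
    ‖a ^ 3 + b ^ 3‖ ≤ ‖a + b‖ * (3 / 2 * (‖a‖ ^ 2 + ‖b‖ ^ 2)) := by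
  have e : a ^ 3 + b ^ 3 = (a + b) * (a ^ 2 - a * b + b ^ 2) := by ring
  rw [e, norm_mul]
  refine mul_le_mul_of_nonneg_left ?_ (norm_nonneg _)
  have h1 : ‖a ^ 2 - a * b + b ^ 2‖ ≤ ‖a‖ ^ 2 + ‖a‖ * ‖b‖ + ‖b‖ ^ 2 := by
    refine (norm_add_le _ _).trans ?_
    rw [norm_pow b]
    refine add_le_add_left ((norm_sub_le _ _).trans ?_) _
    rw [norm_pow, norm_mul]
  nlinarith [sq_nonneg (‖a‖ - ‖b‖)]

lemma norm_sum_cube_sub_le {κ : Type*} (s : Finset κ) (v : κ → ℂ) {ρ : ℝ}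
    (hv : ∀ i ∈ s, ‖v i‖ ≤ ρ) :
    ‖(∑ i ∈ s, v i) ^ 3 - ∑ i ∈ s, v i ^ 3‖ ≤
      (s.card + 1) * ρ * ∑ i ∈ s, ∑ l ∈ s.erase i, ‖v i‖ * ‖v l‖ := by
  have e : (∑ i ∈ s, v i) ^ 3 - ∑ i ∈ s, v i ^ 3 =
      ∑ i ∈ s, v i * ((∑ l ∈ s.erase i, v l) * ((∑ l ∈ s, v l) + v i)) := by
    rw [pow_succ', Finset.sum_mul, ← Finset.sum_sub_distrib]
    refine Finset.sum_congr rfl fun i hi => ?_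
    have := Finset.add_sum_erase s v hi
    rw [← this]
    ring
  rw [e, Finset.mul_sum]
  refine (norm_sum_le _ _).trans (Finset.sum_le_sum fun i hi => ?_)
  rw [norm_mul, norm_mul, ← Finset.mul_sum]
  have h1 : ‖∑ l ∈ s.erase i, v l‖ ≤ ∑ l ∈ s.erase i, ‖v l‖ := norm_sum_le _ _
  have h2 : ‖(∑ l ∈ s, v l) + v i‖ ≤ (s.card + 1) * ρ := by
    refine (norm_add_le _ _).trans ?_
    have : ‖∑ l ∈ s, v l‖ ≤ s.card * ρ := by
      refine (norm_sum_le _ _).trans ((Finset.sum_le_sum hv).trans ?_)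
      rw [Finset.sum_const, nsmul_eq_mul]
    linarith [hv i hi]
  calc ‖v i‖ * (‖∑ l ∈ s.erase i, v l‖ * ‖(∑ l ∈ s, v l) + v i‖)
      ≤ ‖v i‖ * ((∑ l ∈ s.erase i, ‖v l‖) * ((s.card + 1) * ρ)) := by gcongr
    _ = _ := by ring

lemma norm_sum_sq_le {κ : Type*} (s : Finset κ) (v : κ → ℂ) :
    ‖∑ i ∈ s, v i‖ ^ 2 ≤ s.card * ∑ i ∈ s, ‖v i‖ ^ 2 := by
  refine le_trans (pow_le_pow_left₀ (norm_nonneg _) (norm_sum_le _ _) 2) ?_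
  exact sq_sum_le_card_mul_sum_sq

end CubeInequalities

section CubeSums

variable {ι G : Type*} [Fintype ι] [AddCommGroup G] [Fintype G]

/-- The third moment of the Fourier coefficients over the tuples with support `A`. -/
def supportCubeSum (G : Type*) [AddCommGroup G] [Fintype G] (A : Finset ι) : ℂ :=
  ∑ χ ∈ withSupport G A, bijFourier χ ^ 3

/-- The term `i` of the recursion at `j` if the two characters there cancel, and `0` otherwise. -/
def cancellingPart (χ : ι → AddChar G ℂ) (j i : ι) : ℂ :=
  if χ i * χ j = 1 then bijFourier (merge χ i j) else 0

/-- The tuples with support `A` whose characters at `i` and `j` cancel are parametrised by the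
merged tuple and the character at `j`. -/
lemma sum_withSupport_cancelling {M : Type*} [AddCommMonoid M] {A : Finset ι} {i j : ι}
    (hj : j ∈ A) (hi : i ∈ A.erase j) (g : (ι → AddChar G ℂ) → AddChar G ℂ → M) :
    ∑ χ ∈ withSupport G A, (if χ i * χ j = 1 then g (merge χ i j) (χ j) else 0) =
      ∑ η ∈ withSupport G ((A.erase j).erase i), ∑ t ∈ univ.erase 1, g η t := by
  have hij := (mem_erase.1 hi).1
  have hA : A = insert j (insert i ((A.erase j).erase i)) := by
    rw [insert_erase hi, insert_erase hj]
  conv_lhs => rw [hA]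
  rw [sum_withSupport_insert (by simp [hij.symm]), sum_withSupport_insert (by simp)]
  refine Finset.sum_congr rfl fun η hη => ?_
  have hηj := eq_one_of_notMem_support hη (j := j) (by simp)
  have hηi := eq_one_of_notMem_support hη (j := i) (by simp)
  rw [Finset.sum_comm]
  refine Finset.sum_congr rfl fun t ht => ?_
  rw [Finset.sum_eq_single t⁻¹]
  · rw [merge_update_update hij hηj]
    simp [hij, ← hηi]
  · intro s _ hs
    rw [if_neg]
    simp only [update_self, update_of_ne hij]
    exact fun h => hs (eq_inv_of_mul_eq_one_left h)
  · intro h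
    simp only [mem_erase, mem_univ, and_true, ne_eq, inv_eq_one, not_not] at h ht
    exact absurd h ht

lemma card_univ_erase_one (hc : Fintype.card ι = Fintype.card G) :
    ((univ : Finset (AddChar G ℂ)).erase 1).card = Fintype.card ι - 1 := by
  rw [card_erase_of_mem (mem_univ _), card_univ, AddChar.card_eq, hc]

lemma sum_cancellingPart_cube (hc : Fintype.card ι = Fintype.card G) {A : Finset ι} {i j : ι}
    (hj : j ∈ A) (hi : i ∈ A.erase j) :
    ∑ χ ∈ withSupport G A, cancellingPart χ j i ^ 3 =
      ((Fintype.card ι - 1 : ℕ) : ℂ) * supportCubeSum G ((A.erase j).erase i) := by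
  have := sum_withSupport_cancelling (G := G) hj hi (fun η _ => bijFourier η ^ 3)
  simp only [Finset.sum_const, card_univ_erase_one hc, nsmul_eq_mul] at this
  rw [supportCubeSum, Finset.mul_sum, ← this]
  refine Finset.sum_congr rfl fun χ _ => ?_
  unfold cancellingPart
  split_ifs <;> simp

lemma sum_cancellingPart_sq (hc : Fintype.card ι = Fintype.card G) {A : Finset ι} {i j : ι}
    (hj : j ∈ A) (hi : i ∈ A.erase j) :
    ∑ χ ∈ withSupport G A, ‖cancellingPart χ j i‖ ^ 2 =
      ((Fintype.card ι - 1 : ℕ) : ℝ) * supportEnergy G ((A.erase j).erase i) := by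
  have := sum_withSupport_cancelling (G := G) hj hi (fun η _ => ‖bijFourier η‖ ^ 2)
  simp only [Finset.sum_const, card_univ_erase_one hc, nsmul_eq_mul] at this
  rw [supportEnergy, Finset.mul_sum, ← this]
  refine Finset.sum_congr rfl fun χ _ => ?_
  unfold cancellingPart
  split_ifs <;> simp

/-- If the entry at `l` is also inverse to the one at `j`, then the merged tuple determines the
character at `j`, and the factor `n - 1` of `sum_cancellingPart_sq` is absent. -/
lemma sum_cancellingPart_sq_of_mul_eq_one {A : Finset ι} {i j l : ι}
    (hj : j ∈ A) (hi : i ∈ A.erase j) (hl : l ∈ (A.erase j).erase i) :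
    ∑ χ ∈ withSupport G A, (if χ l * χ j = 1 then ‖cancellingPart χ j i‖ ^ 2 else 0) ≤
      supportEnergy G ((A.erase j).erase i) := by
  have := sum_withSupport_cancelling (G := G) hj hi
    (fun η t => if η l * t = 1 then ‖bijFourier η‖ ^ 2 else 0)
  have hli := (mem_erase.1 hl).1
  have hlj := (mem_erase.1 (mem_erase.1 hl).2).1
  refine le_trans (le_of_eq ?_) (this.trans_le ?_)
  · refine Finset.sum_congr rfl fun χ _ => ?_
    unfold cancellingPart
    have : merge χ i j l = χ l := by simp [merge, hli, hlj]
    rw [this]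
    split_ifs <;> simp
  · refine Finset.sum_le_sum fun η _ => ?_
    calc _ ≤ ∑ t, (if η l * t = 1 then ‖bijFourier η‖ ^ 2 else 0) := by
          refine Finset.sum_le_sum_of_subset_of_nonneg (subset_univ _) fun t _ _ => ?_
          split_ifs <;> positivity
      _ = ∑ t, (if t = (η l)⁻¹ then ‖bijFourier η‖ ^ 2 else 0) := by
          refine Finset.sum_congr rfl fun t _ => ?_
          simp only [mul_eq_one_iff_eq_inv']
      _ = _ := by simp

lemma sum_cancellingPart_mul_le {A : Finset ι} {i j l : ι}
    (hj : j ∈ A) (hi : i ∈ A.erase j) (hl : l ∈ (A.erase j).erase i) :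
    ∑ χ ∈ withSupport G A, ‖cancellingPart χ j i‖ * ‖cancellingPart χ j l‖ ≤
      supportEnergy G ((A.erase j).erase i) + supportEnergy G ((A.erase j).erase l) := by
  have hl' : l ∈ A.erase j := (mem_erase.1 hl).2
  have hi' : i ∈ (A.erase j).erase l := mem_erase.2 ⟨(mem_erase.1 hl).1.symm, hi⟩
  refine le_trans ?_ (add_le_add (sum_cancellingPart_sq_of_mul_eq_one (G := G) hj hi hl)
    (sum_cancellingPart_sq_of_mul_eq_one (G := G) hj hl' hi'))
  rw [← Finset.sum_add_distrib]
  refine Finset.sum_le_sum fun χ _ => ?_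
  by_cases h1 : χ i * χ j = 1
  · by_cases h2 : χ l * χ j = 1
    · rw [if_pos h1, if_pos h2]
      nlinarith [sq_nonneg (‖cancellingPart χ j i‖ - ‖cancellingPart χ j l‖),
        sq_nonneg (‖cancellingPart χ j i‖ + ‖cancellingPart χ j l‖)]
    · have : cancellingPart χ j l = 0 := by simp [cancellingPart, h2]
      rw [this, norm_zero, mul_zero]
      positivity
  · have : cancellingPart χ j i = 0 := by simp [cancellingPart, h1]
    rw [this, norm_zero, zero_mul]
    positivity

/-- Up to lower order terms, the recursion for the Fourier coefficients can be cubed term by term.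
The first error term comes from the pairs that do not cancel, the second from tuples in which
several entries are inverse to the one at `j`. -/
lemma supportCubeSum_recursion (hc : Fintype.card ι = Fintype.card G)
    (hodd : Odd (Fintype.card G)) {k : ℕ} (hn : 256 * (k + 2) ≤ Fintype.card ι) {A : Finset ι}
    (hA : A.card = k + 2) {j : ι} (hj : j ∈ A) :
    ‖((Fintype.card ι - (k + 2) + 1 : ℕ) : ℂ) ^ 3 * supportCubeSum G A +
      ((Fintype.card ι - 1 : ℕ) : ℂ) * ∑ i ∈ A.erase j, supportCubeSum G ((A.erase j).erase i)‖ ≤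
      (k + 1) * decayBound (4 / 5) (Fintype.card ι) (k + 1) * (3 / 2 *
        ((Fintype.card ι) ^ 2 * decayBound (6 / 5) (Fintype.card ι) (k + 2) +
          (k + 1) ^ 2 * Fintype.card ι * decayBound (6 / 5) (Fintype.card ι) k)) +
      2 * (k + 2) ^ 3 * decayBound (4 / 5) (Fintype.card ι) k *
        decayBound (6 / 5) (Fintype.card ι) k := by
  set n := Fintype.card ι with hndef
  set N : ℕ := n - (k + 2) + 1 with hN
  have hcardE : (A.erase j).card = k + 1 := by rw [card_erase_of_mem hj, hA]; rfl
  have hNn : (N : ℝ) ≤ n := by exact_mod_cast (by omega : N ≤ n)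
  -- the non-cancelling part of the recursion is small
  have hdiff : ∀ χ ∈ withSupport G A, ‖(N : ℂ) * bijFourier χ +
      ∑ i ∈ A.erase j, cancellingPart χ j i‖ ≤ (k + 1) * decayBound (4 / 5) n (k + 1) := by
    intro χ hχ
    rw [mem_withSupport] at hχ
    have hrec := bijFourier_recursion hχ hj
    rw [hA] at hrec
    rw [hrec, neg_add_eq_sub, ← Finset.sum_sub_distrib]
    refine (norm_sum_le _ _).trans ?_
    have : ∀ i ∈ A.erase j, ‖cancellingPart χ j i - bijFourier (merge χ i j)‖ ≤
        decayBound (4 / 5) n (k + 1) := by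
      intro i hi
      unfold cancellingPart
      split_ifs with h
      · rw [sub_self, norm_zero]; exact decayBound_nonneg _ _ _
      · rw [zero_sub, norm_neg]
        refine norm_bijFourier_le hc hodd _ _ ?_ (by omega)
        rw [charSupport_merge_of_mul_ne_one (mem_erase.1 hi).1
          (mem_charSupport.1 (hχ ▸ (mem_erase.1 hi).2)) h, hχ, hcardE]
    refine (Finset.sum_le_sum this).trans ?_
    rw [Finset.sum_const, hcardE, nsmul_eq_mul]
    push_cast
    rfl
  have hv : ∀ χ ∈ withSupport G A, ∀ i ∈ A.erase j,
      ‖cancellingPart χ j i‖ ≤ decayBound (4 / 5) n k := by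
    intro χ hχ i hi
    rw [mem_withSupport] at hχ
    unfold cancellingPart
    split_ifs with h
    · refine norm_bijFourier_le hc hodd _ _ ?_ (by omega)
      rw [charSupport_merge_of_mul_eq_one h, hχ, card_erase_of_mem hi, hcardE]; rfl
    · rw [norm_zero]; exact decayBound_nonneg _ _ _
  have hL : ∀ i ∈ A.erase j, supportEnergy G ((A.erase j).erase i) ≤ decayBound (6 / 5) n k := by
    intro i hi
    exact supportEnergy_le hc k _ (by rw [card_erase_of_mem hi, hcardE]; rfl) (by omega)
  have hLA := supportEnergy_le hc (k + 2) A hA hn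
  -- First the recursion is replaced by its cancelling terms, then the cube of their sum by the
  -- sum of their cubes.
  have hdecomp : (N : ℂ) ^ 3 * supportCubeSum G A +
      ((n - 1 : ℕ) : ℂ) * ∑ i ∈ A.erase j, supportCubeSum G ((A.erase j).erase i) =
      ∑ χ ∈ withSupport G A, (((N : ℂ) * bijFourier χ) ^ 3 +
          (∑ i ∈ A.erase j, cancellingPart χ j i) ^ 3) -
        ∑ χ ∈ withSupport G A, ((∑ i ∈ A.erase j, cancellingPart χ j i) ^ 3 -
          ∑ i ∈ A.erase j, cancellingPart χ j i ^ 3) := by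
    have : ((n - 1 : ℕ) : ℂ) * ∑ i ∈ A.erase j, supportCubeSum G ((A.erase j).erase i) =
        ∑ χ ∈ withSupport G A, ∑ i ∈ A.erase j, cancellingPart χ j i ^ 3 := by
      rw [Finset.sum_comm, Finset.mul_sum]
      exact Finset.sum_congr rfl fun i hi => (sum_cancellingPart_cube hc hj hi).symm
    rw [this, supportCubeSum, Finset.mul_sum, ← Finset.sum_add_distrib, ← Finset.sum_sub_distrib]
    refine Finset.sum_congr rfl fun χ _ => ?_
    ring
  rw [hdecomp]
  refine (norm_sub_le _ _).trans (add_le_add ?_ ?_)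
  · refine (norm_sum_le _ _).trans ?_
    have h1 : ∀ χ ∈ withSupport G A, ‖((N : ℂ) * bijFourier χ) ^ 3 +
        (∑ i ∈ A.erase j, cancellingPart χ j i) ^ 3‖ ≤
        (k + 1) * decayBound (4 / 5) n (k + 1) * (3 / 2 * ((n : ℝ) ^ 2 * ‖bijFourier χ‖ ^ 2 +
          (k + 1) * ∑ i ∈ A.erase j, ‖cancellingPart χ j i‖ ^ 2)) := by
      intro χ hχ
      refine (norm_cube_add_cube_le _ _).trans ?_
      refine mul_le_mul (hdiff χ hχ) ?_ (by positivity)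
        (mul_nonneg (by positivity) (decayBound_nonneg _ _ _))
      refine mul_le_mul_of_nonneg_left (add_le_add ?_ ?_) (by norm_num)
      · rw [norm_mul, mul_pow, Complex.norm_natCast]
        gcongr
      · refine (norm_sum_sq_le _ _).trans (le_of_eq ?_)
        rw [hcardE]; push_cast; rfl
    refine (Finset.sum_le_sum h1).trans ?_
    rw [← Finset.mul_sum, ← Finset.mul_sum, Finset.sum_add_distrib, ← Finset.mul_sum,
      ← Finset.mul_sum, Finset.sum_comm]
    refine mul_le_mul_of_nonneg_left ?_ (mul_nonneg (by positivity) (decayBound_nonneg _ _ _))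
    refine mul_le_mul_of_nonneg_left (add_le_add ?_ ?_) (by norm_num)
    · exact mul_le_mul_of_nonneg_left hLA (by positivity)
    · have h2 : ∑ i ∈ A.erase j, ∑ χ ∈ withSupport G A, ‖cancellingPart χ j i‖ ^ 2 ≤
          ∑ i ∈ A.erase j, n * decayBound (6 / 5) n k := by
        refine Finset.sum_le_sum fun i hi => ?_
        rw [sum_cancellingPart_sq hc hj hi]
        have : ((n - 1 : ℕ) : ℝ) ≤ n := by exact_mod_cast Nat.sub_le n 1
        exact mul_le_mul this (hL i hi) (supportEnergy_nonneg _) (by positivity)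
      rw [Finset.sum_const, hcardE, nsmul_eq_mul] at h2
      push_cast at h2
      calc _ ≤ ((k : ℝ) + 1) * ((k + 1) * (n * decayBound (6 / 5) n k)) := by gcongr
        _ = _ := by ring
  · refine (norm_sum_le _ _).trans ?_
    refine (Finset.sum_le_sum fun χ hχ => norm_sum_cube_sub_le _ _ (hv χ hχ)).trans ?_
    rw [← Finset.mul_sum, hcardE, Finset.sum_comm]
    have h1 : ∑ i ∈ A.erase j, ∑ χ ∈ withSupport G A, ∑ l ∈ (A.erase j).erase i,
        ‖cancellingPart χ j i‖ * ‖cancellingPart χ j l‖ ≤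
        ∑ i ∈ A.erase j, (k * (2 * decayBound (6 / 5) n k)) := by
      refine Finset.sum_le_sum fun i hi => ?_
      rw [Finset.sum_comm]
      have : ∀ l ∈ (A.erase j).erase i, ∑ χ ∈ withSupport G A,
          ‖cancellingPart χ j i‖ * ‖cancellingPart χ j l‖ ≤ 2 * decayBound (6 / 5) n k := by
        intro l hl
        refine (sum_cancellingPart_mul_le hj hi hl).trans ?_
        linarith [hL i hi, hL l (mem_erase.1 hl).2]
      refine (Finset.sum_le_sum this).trans (le_of_eq ?_)
      rw [Finset.sum_const, card_erase_of_mem hi, hcardE, nsmul_eq_mul]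
      simp
    rw [Finset.sum_const, hcardE, nsmul_eq_mul] at h1
    push_cast at h1 ⊢
    have hu := decayBound_nonneg (4 / 5) n k
    have hw := decayBound_nonneg (6 / 5) n k
    have hk : (0 : ℝ) ≤ k := Nat.cast_nonneg k
    calc _ ≤ ((k : ℝ) + 1 + 1) * decayBound (4 / 5) n k *
          ((k + 1) * (k * (2 * decayBound (6 / 5) n k))) := by gcongr
      _ ≤ ((k : ℝ) + 2) * decayBound (4 / 5) n k *
          ((k + 2) * ((k + 2) * (2 * decayBound (6 / 5) n k))) := by
          rw [show (k : ℝ) + 1 + 1 = k + 2 by ring]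
          gcongr <;> linarith
      _ = _ := by ring

lemma norm_supportCubeSum_le (hc : Fintype.card ι = Fintype.card G)
    (hodd : Odd (Fintype.card G)) {A : Finset ι} (hn : 256 * A.card ≤ Fintype.card ι) :
    ‖supportCubeSum G A‖ ≤ decayBound (4 / 5) (Fintype.card ι) A.card *
      decayBound (6 / 5) (Fintype.card ι) A.card := by
  refine (norm_sum_le _ _).trans ?_
  refine le_trans ?_ (mul_le_mul_of_nonneg_left (supportEnergy_le hc _ A rfl hn)
    (decayBound_nonneg _ _ _))
  rw [supportEnergy, Finset.mul_sum]
  refine Finset.sum_le_sum fun χ hχ => ?_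
  rw [norm_pow, pow_succ']
  refine mul_le_mul_of_nonneg_right ?_ (by positivity)
  exact norm_bijFourier_le hc hodd _ χ (by rw [mem_withSupport.1 hχ]) hn

end CubeSums

/-! ### Limits of the sparse cubic sums -/

section Limits

lemma decayBound_eq {b : ℝ} (hb : 0 ≤ b) (n m : ℕ) :
    decayBound b n m = √(m.factorial * b ^ m) / √n ^ m := by
  unfold decayBound
  rw [div_pow, ← mul_div_assoc, Real.sqrt_div (by positivity)]
  congr 1
  rw [Real.sqrt_eq_iff_eq_sq (by positivity) (by positivity), ← pow_mul, mul_comm m 2, pow_mul,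
    Real.sq_sqrt (by positivity)]

/-- The limit of the total third moment over supports of size `m`; see `sparseCubeSum_limit`. -/
def limitCoeff : ℕ → ℝ
  | 0 => 1
  | 1 => 0
  | m + 2 => -limitCoeff m / (m + 2)

lemma factorial_mul_limitCoeff (k : ℕ) :
    ((k + 2).factorial : ℝ) * limitCoeff (k + 2) = -((k + 1) * (k.factorial * limitCoeff k)) := by
  rw [limitCoeff, Nat.factorial_succ, Nat.factorial_succ]
  push_cast
  field_simp
  ring

/-- One step of the recursion for the rescaled third moments: if `q E + p T` is small, `q` and `p`
are close to `1`, and `T` is close to `K κ`, then `E` is close to `-K κ`. -/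
lemma norm_limit_step {q p E T κ : ℂ} {K C' C h : ℝ} (hK : 0 ≤ K)
    (hC : 0 ≤ C) (hh : 0 ≤ h) (hh1 : h ≤ 1) (hq : ‖q - 1‖ ≤ 3 * K * h) (hq' : 1 / 2 ≤ ‖q‖)
    (hp : ‖p - 1‖ ≤ h) (h1 : ‖q * E + p * T‖ ≤ C' * h) (h2 : ‖T - K * κ‖ ≤ K * (C * h)) :
    ‖E + K * κ‖ ≤ (C' + K * (‖κ‖ + C) + K * C + 6 * K * (C' + 2 * (K * (‖κ‖ + C)))) * h := by
  have hC' : 0 ≤ C' * h := (norm_nonneg _).trans h1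
  have hT : ‖T‖ ≤ K * (‖κ‖ + C) := by
    have e : T = (T - K * κ) + K * κ := by ring
    rw [e]
    refine (norm_add_le _ _).trans ?_
    rw [norm_mul, Complex.norm_real, Real.norm_of_nonneg hK]
    nlinarith [mul_nonneg hK hC]
  have hKp : 0 ≤ K * (‖κ‖ + C) := (norm_nonneg _).trans hT
  have hp2 : ‖p‖ ≤ 2 := by
    have e : p = (p - 1) + 1 := by ring
    rw [e]
    refine (norm_add_le _ _).trans ?_
    rw [norm_one]; linarith
  have hE : ‖E‖ ≤ 2 * (C' * h + 2 * (K * (‖κ‖ + C))) := by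
    have e : q * E = (q * E + p * T) - p * T := by ring
    have h3 : ‖q‖ * ‖E‖ ≤ C' * h + 2 * (K * (‖κ‖ + C)) := by
      rw [← norm_mul, e]
      refine (norm_sub_le _ _).trans (add_le_add h1 ?_)
      rw [norm_mul]
      exact mul_le_mul hp2 hT (norm_nonneg _) (by norm_num)
    nlinarith [norm_nonneg E]
  have e : E + K * κ = (q * E + p * T) - (p - 1) * T - (T - K * κ) - (q - 1) * E := by ring
  rw [e]
  have b1 : ‖(p - 1) * T‖ ≤ h * (K * (‖κ‖ + C)) := by
    rw [norm_mul]; exact mul_le_mul hp hT (norm_nonneg _) hh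
  have b2 : ‖(q - 1) * E‖ ≤ 3 * K * h * (2 * (C' * h + 2 * (K * (‖κ‖ + C)))) := by
    rw [norm_mul]; exact mul_le_mul hq hE (norm_nonneg _) (by positivity)
  have b3 : 3 * K * h * (2 * (C' * h + 2 * (K * (‖κ‖ + C)))) ≤
      6 * K * (C' + 2 * (K * (‖κ‖ + C))) * h := by
    rcases hh.eq_or_lt with h0 | h0
    · rw [← h0]; simp
    have hC'' : 0 ≤ C' := nonneg_of_mul_nonneg_left hC' h0
    have : C' * h ≤ C' := mul_le_of_le_one_right hC'' hh1
    have := mul_nonneg hK hh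
    nlinarith
  calc _ ≤ ‖q * E + p * T‖ + ‖(p - 1) * T‖ + ‖T - K * κ‖ + ‖(q - 1) * E‖ := by
        refine (norm_sub_le _ _).trans (add_le_add_left ((norm_sub_le _ _).trans
          (add_le_add_left (norm_sub_le _ _) _)) _)
    _ ≤ _ := by linarith

lemma norm_pow_three_sub_one_le {x δ : ℝ} (h0 : 0 ≤ x) (h1 : x ≤ 1) (h : 1 - x ≤ δ) :
    ‖(x : ℂ) ^ 3 - 1‖ ≤ 3 * δ := by
  rw [← Complex.ofReal_pow, ← Complex.ofReal_one, ← Complex.ofReal_sub, Complex.norm_real,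
    Real.norm_eq_abs, abs_sub_comm, abs_of_nonneg (by linarith [pow_le_one₀ (n := 3) h0 h1])]
  nlinarith [mul_nonneg h0 h0, mul_nonneg (sub_nonneg.2 h1) h0]

/-- The third moment over a support of size `m` is `m! * limitCoeff m / n ^ m` up to an error
`O(n ^ (-m - 1/2))`, uniformly in the group and the support. -/
lemma supportCubeSum_limit (m : ℕ) : ∃ C : ℝ, 0 ≤ C ∧ ∀ (ι : Type*) (G : Type*) [Fintype ι]
    [AddCommGroup G] [Fintype G], Fintype.card ι = Fintype.card G → Odd (Fintype.card G) →
    256 * m ≤ Fintype.card ι → ∀ A : Finset ι, A.card = m →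
    ‖(Fintype.card ι : ℂ) ^ m * supportCubeSum G A - ((m.factorial * limitCoeff m : ℝ) : ℂ)‖ ≤
      C / √(Fintype.card ι) := by
  induction m using Nat.twoStepInduction with
  | zero =>
    refine ⟨0, le_rfl, fun ι G _ _ _ hc _ _ A hA => ?_⟩
    rw [Finset.card_eq_zero.1 hA, supportCubeSum, withSupport_empty]
    simp [bijFourier_one hc, limitCoeff]
  | one =>
    refine ⟨0, le_rfl, fun ι G _ _ _ hc _ _ A hA => ?_⟩
    have : supportCubeSum G A = 0 := by
      refine Finset.sum_eq_zero fun χ hχ => ?_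
      rw [mem_withSupport] at hχ
      rw [bijFourier_eq_zero_of_card_one (by rw [hχ, hA])]
      simp
    simp [this, limitCoeff]
  | more k ih0 _ =>
    obtain ⟨C, hC, ih⟩ := ih0
    set κ : ℝ := k.factorial * limitCoeff k with hκ
    set cu0 := √(k.factorial * (4 / 5 : ℝ) ^ k) with hcu0
    set cu1 := √((k + 1).factorial * (4 / 5 : ℝ) ^ (k + 1)) with hcu1
    set cv0 := √(k.factorial * (6 / 5 : ℝ) ^ k) with hcv0
    set cv2 := √((k + 2).factorial * (6 / 5 : ℝ) ^ (k + 2)) with hcv2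
    set C' : ℝ := (k + 1) * cu1 * (3 / 2 * (cv2 + (k + 1) ^ 2 * cv0)) +
      2 * (k + 2) ^ 3 * cu0 * cv0 with hC'
    have hC'0 : 0 ≤ C' := by positivity
    refine ⟨C' + (k + 1 : ℝ) * (‖(κ : ℂ)‖ + C) + (k + 1 : ℝ) * C +
      6 * (k + 1 : ℝ) * (C' + 2 * ((k + 1 : ℝ) * (‖(κ : ℂ)‖ + C))), by positivity, ?_⟩
    intro ι G _ _ _ hc hodd hn A hA
    obtain ⟨j, hj⟩ : A.Nonempty := Finset.card_pos.1 (by omega)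
    have hrec := supportCubeSum_recursion hc hodd hn hA hj
    have ihn := ih ι G hc hodd (by omega)
    set n := Fintype.card ι with hndef
    have hn0 : (0 : ℝ) < n := by exact_mod_cast (by omega : 0 < n)
    have hnC : (n : ℂ) ≠ 0 := Nat.cast_ne_zero.2 (by omega)
    set r : ℝ := √n with hr
    have hr0 : 0 < r := Real.sqrt_pos.2 hn0
    have hrn : r ^ 2 = n := Real.sq_sqrt hn0.le
    have hr1 : 1 ≤ r := Real.one_le_sqrt.2 (by exact_mod_cast (by omega : 1 ≤ n))
    have hcardE : (A.erase j).card = k + 1 := by rw [card_erase_of_mem hj, hA]; rfl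
    have hinv : 1 / (n : ℝ) ≤ 1 / r := by
      rw [← hrn]
      exact one_div_le_one_div_of_le hr0 (by nlinarith)
    set x : ℝ := ((n - (k + 2) + 1 : ℕ) : ℝ) / n with hx
    have hxval : x = 1 - (k + 1) / n := by
      rw [hx, Nat.cast_add, Nat.cast_sub (by omega)]
      push_cast
      field_simp
      ring
    have hx99 : 99 / 100 ≤ x := by
      rw [hx, le_div_iff₀ hn0]
      exact card_sub_lower (by omega)
    have hx1 : x ≤ 1 := by
      rw [hxval]
      have : (0 : ℝ) ≤ (k + 1) / n := by positivity
      linarith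
    rw [factorial_mul_limitCoeff, ← hκ, Complex.ofReal_neg, sub_neg_eq_add]
    have hfin := norm_limit_step (q := (x : ℂ) ^ 3) (p := (((n - 1 : ℕ) : ℝ) / n : ℝ))
      (E := (n : ℂ) ^ (k + 2) * supportCubeSum G A)
      (T := ∑ i ∈ A.erase j, (n : ℂ) ^ k * supportCubeSum G ((A.erase j).erase i))
      (κ := κ) (K := k + 1) (C' := C') (C := C) (h := 1 / r) (by positivity) hC (by positivity)
      (by rw [div_le_one hr0]; exact hr1) ?_ ?_ ?_ ?_ ?_
    · rw [div_eq_mul_one_div]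
      refine le_trans (le_of_eq ?_) hfin
      push_cast
      rfl
    · refine (norm_pow_three_sub_one_le (by linarith) hx1 (le_refl _)).trans ?_
      rw [hxval]
      have : (1 - (1 - ((k : ℝ) + 1) / n)) ≤ (k + 1) * (1 / r) := by
        have := mul_le_mul_of_nonneg_left hinv (by positivity : (0 : ℝ) ≤ k + 1)
        calc _ = ((k : ℝ) + 1) * (1 / n) := by ring
          _ ≤ _ := this
      linarith
    · rw [norm_pow, Complex.norm_real, Real.norm_of_nonneg (by linarith)]
      calc (1 / 2 : ℝ) ≤ (99 / 100) ^ 3 := by norm_num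
        _ ≤ x ^ 3 := by gcongr
    · rw [← Complex.ofReal_one, ← Complex.ofReal_sub, Complex.norm_real,
        Nat.cast_sub (by omega)]
      have : (((n : ℝ) - (1 : ℕ)) / n - 1) = -(1 / n) := by
        field_simp; push_cast; ring
      rw [this, norm_neg, Real.norm_of_nonneg (by positivity)]
      exact hinv
    · have e : (x : ℂ) ^ 3 * ((n : ℂ) ^ (k + 2) * supportCubeSum G A) +
          ((((n - 1 : ℕ) : ℝ) / n : ℝ) : ℂ) *
            ∑ i ∈ A.erase j, (n : ℂ) ^ k * supportCubeSum G ((A.erase j).erase i) =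
          ((n : ℂ) ^ (k + 2) / n ^ 3) * (((n - (k + 2) + 1 : ℕ) : ℂ) ^ 3 * supportCubeSum G A +
            ((n - 1 : ℕ) : ℂ) * ∑ i ∈ A.erase j, supportCubeSum G ((A.erase j).erase i)) := by
        rw [← Finset.mul_sum, hx]
        push_cast
        field_simp
        ring
      rw [e, norm_mul]
      have e2 : ‖(n : ℂ) ^ (k + 2) / n ^ 3‖ = r ^ (2 * k + 4) / r ^ 6 := by
        rw [norm_div, norm_pow, norm_pow, Complex.norm_natCast, ← hrn, ← pow_mul, ← pow_mul]
        ring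
      rw [e2]
      refine (mul_le_mul_of_nonneg_left hrec (by positivity)).trans ?_
      rw [decayBound_eq (by norm_num), decayBound_eq (by norm_num), decayBound_eq (by norm_num),
        decayBound_eq (by norm_num), ← hcu0, ← hcu1, ← hcv0, ← hcv2, ← hr, ← hrn]
      have e3 : r ^ (2 * k + 4) / r ^ 6 * ((k + 1) * (cu1 / r ^ (k + 1)) * (3 / 2 *
          ((r ^ 2) ^ 2 * (cv2 / r ^ (k + 2)) + (k + 1) ^ 2 * r ^ 2 * (cv0 / r ^ k))) +
          2 * (k + 2) ^ 3 * (cu0 / r ^ k) * (cv0 / r ^ k)) =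
          (k + 1) * cu1 * (3 / 2 * (cv2 + (k + 1) ^ 2 * cv0)) * (1 / r) +
            2 * (k + 2) ^ 3 * cu0 * cv0 * (1 / r * (1 / r)) := by
        field_simp
        ring
      have hrr : 1 / r * (1 / r) ≤ 1 / r := by
        refine mul_le_of_le_one_right (by positivity) ?_
        rw [div_le_one hr0]; exact hr1
      have hle := mul_le_mul_of_nonneg_left hrr
        (by positivity : 0 ≤ 2 * ((k : ℝ) + 2) ^ 3 * cu0 * cv0)
      rw [e3, hC', add_mul ((k + 1) * cu1 * (3 / 2 * (cv2 + (k + 1) ^ 2 * cv0)))]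
      linarith
    · have : ∑ i ∈ A.erase j, (n : ℂ) ^ k * supportCubeSum G ((A.erase j).erase i) -
          ((k + 1 : ℝ) : ℂ) * (κ : ℂ) =
          ∑ i ∈ A.erase j, ((n : ℂ) ^ k * supportCubeSum G ((A.erase j).erase i) - (κ : ℂ)) := by
        rw [Finset.sum_sub_distrib, Finset.sum_const, hcardE, nsmul_eq_mul]
        push_cast
        rfl
      rw [this]
      refine (norm_sum_le _ _).trans ?_
      refine (Finset.sum_le_sum (g := fun _ => C / r) fun i hi => ?_).trans ?_
      · exact ihn _ (by rw [card_erase_of_mem hi, hcardE]; rfl)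
      · rw [Finset.sum_const, hcardE, nsmul_eq_mul]
        push_cast
        rw [div_eq_mul_one_div C r]

variable {ι G : Type*} [Fintype ι] [AddCommGroup G] [Fintype G]

/-- The third moment of the Fourier coefficients over all tuples with exactly `m` nontrivial
entries. -/
def sparseCubeSum (ι G : Type*) [Fintype ι] [AddCommGroup G] [Fintype G] (m : ℕ) : ℂ :=
  ∑ A ∈ (univ : Finset ι).powersetCard m, supportCubeSum G A

lemma norm_sparseCubeSum_le (hc : Fintype.card ι = Fintype.card G)
    (hodd : Odd (Fintype.card G)) {m : ℕ} (hn : 256 * m ≤ Fintype.card ι) :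
    ‖sparseCubeSum ι G m‖ ≤ √(24 / 25) ^ m := by
  have h1 : ‖sparseCubeSum ι G m‖ ≤
      ∑ A ∈ (univ : Finset ι).powersetCard m, (m.factorial : ℝ) / (Fintype.card ι) ^ m *
        √(24 / 25) ^ m := by
    refine (norm_sum_le _ _).trans (Finset.sum_le_sum fun A hA => ?_)
    have hAm := (mem_powersetCard.1 hA).2
    refine (norm_supportCubeSum_le hc hodd (by rw [hAm]; exact hn)).trans (le_of_eq ?_)
    rw [hAm, decayBound, decayBound, ← Real.sqrt_mul (by positivity),
      Real.sqrt_eq_iff_eq_sq (by positivity) (by positivity), mul_pow, ← pow_mul, mul_comm m 2,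
      pow_mul, Real.sq_sqrt (by norm_num), show (24 / 25 : ℝ) = 4 / 5 * (6 / 5) by norm_num]
    simp only [div_pow, mul_pow]
    ring
  refine h1.trans ?_
  rw [Finset.sum_const, card_powersetCard, nsmul_eq_mul, card_univ, ← mul_assoc]
  refine mul_le_of_le_one_left (by positivity) ?_
  rw [← mul_div_assoc, ← Nat.cast_mul, mul_comm, ← Nat.descFactorial_eq_factorial_mul_choose]
  refine div_le_one_of_le₀ ?_ (by positivity)
  exact_mod_cast Nat.descFactorial_le_pow _ _

lemma sparseCubeSum_limit (m : ℕ) : ∃ C : ℝ, ∀ (ι : Type*) (G : Type*) [Fintype ι]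
    [AddCommGroup G] [Fintype G], Fintype.card ι = Fintype.card G → Odd (Fintype.card G) →
    256 * m ≤ Fintype.card ι →
    ‖sparseCubeSum ι G m - ((((Fintype.card ι).descFactorial m : ℝ) / (Fintype.card ι) ^ m *
      limitCoeff m : ℝ) : ℂ)‖ ≤ C / √(Fintype.card ι) := by
  obtain ⟨C, hC, h⟩ := supportCubeSum_limit m
  refine ⟨C, fun ι G _ _ _ hc hodd hn => ?_⟩
  have h := h ι G hc hodd hn
  set n := Fintype.card ι
  have hn0 : (n : ℂ) ≠ 0 := by
    have : 0 < Fintype.card G := Fintype.card_pos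
    exact Nat.cast_ne_zero.2 (by omega)
  have e : sparseCubeSum ι G m - (((n.descFactorial m : ℝ) / n ^ m * limitCoeff m : ℝ) : ℂ) =
      ∑ A ∈ (univ : Finset ι).powersetCard m, (1 / (n : ℂ) ^ m) *
        ((n : ℂ) ^ m * supportCubeSum G A - ((m.factorial * limitCoeff m : ℝ) : ℂ)) := by
    have : ∀ A : Finset ι, (1 / (n : ℂ) ^ m) *
        ((n : ℂ) ^ m * supportCubeSum G A - ((m.factorial * limitCoeff m : ℝ) : ℂ)) =
        supportCubeSum G A - 1 / (n : ℂ) ^ m * ((m.factorial * limitCoeff m : ℝ) : ℂ) := by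
      intro A
      field_simp
    simp_rw [this]
    rw [Finset.sum_sub_distrib, sparseCubeSum, Finset.sum_const, card_powersetCard, card_univ,
      nsmul_eq_mul, Nat.descFactorial_eq_factorial_mul_choose]
    push_cast
    ring
  rw [e]
  refine (norm_sum_le _ _).trans ?_
  have h2 : ∀ A ∈ (univ : Finset ι).powersetCard m, ‖(1 / (n : ℂ) ^ m) *
        ((n : ℂ) ^ m * supportCubeSum G A - ((m.factorial * limitCoeff m : ℝ) : ℂ))‖ ≤
        1 / (n : ℝ) ^ m * (C / √n) := by
    intro A hA
    rw [norm_mul, norm_div, norm_one, norm_pow, Complex.norm_natCast]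
    exact mul_le_mul_of_nonneg_left (h A (mem_powersetCard.1 hA).2) (by positivity)
  refine (Finset.sum_le_sum h2).trans ?_
  rw [Finset.sum_const, card_powersetCard, card_univ, nsmul_eq_mul, ← mul_assoc]
  refine mul_le_of_le_one_left (by positivity) ?_
  rw [mul_one_div]
  refine div_le_one_of_le₀ ?_ (by positivity)
  exact_mod_cast Nat.choose_le_pow _ _

end Limits

/-! ### The permanent bound for arbitrary tuples -/

section Counting

variable {ι D : Type*} [Fintype ι]

/-- The number of indices at which `χ` takes the value `r`. -/
def fibreCount (χ : ι → D) (r : D) : ℕ := (univ.filter fun i => χ i = r).card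

lemma fibreCount_le (χ : ι → D) (r : D) : fibreCount χ r ≤ Fintype.card ι :=
  card_le_univ _

lemma exists_perm_of_fibreCount_eq {χ φ : ι → D} (h : fibreCount φ = fibreCount χ) :
    ∃ τ : Equiv.Perm ι, χ ∘ τ = φ := by
  have e : ∀ r, Nonempty ({i // φ i = r} ≃ {i // χ i = r}) := by
    intro r
    refine ⟨Fintype.equivOfCardEq ?_⟩
    rw [Fintype.card_subtype, Fintype.card_subtype]
    exact congrFun h r
  let e' := fun r => (e r).some
  refine ⟨(Equiv.sigmaFiberEquiv φ).symm.trans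
    ((Equiv.sigmaCongrRight e').trans (Equiv.sigmaFiberEquiv χ)), ?_⟩
  funext i
  exact (e' (φ i) ⟨i, rfl⟩).2

variable [Fintype D]

lemma sum_fibreCount (χ : ι → D) : ∑ r, fibreCount χ r = Fintype.card ι := by
  unfold fibreCount
  rw [← card_univ]
  exact (Finset.card_eq_sum_card_fiberwise (fun i _ => mem_coe.2 (mem_univ (χ i)))).symm

lemma prod_comp_eq_prod_pow {M : Type*} [CommMonoid M] (χ : ι → D) (y : D → M) :
    ∏ i, y (χ i) = ∏ r, y r ^ fibreCount χ r := by
  rw [← Finset.prod_fiberwise (univ : Finset ι) χ]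
  refine Finset.prod_congr rfl fun r _ => ?_
  rw [Finset.prod_congr rfl (g := fun _ => y r), Finset.prod_const]
  · rfl
  · intro i hi
    rw [(mem_filter.1 hi).2]

/-- Rearranging `χ` in all possible ways runs over the functions with the same fibre counts, each
attained as often as there are permutations preserving `χ`. -/
lemma sum_perm_comp {M : Type*} [AddCommMonoid M] (χ : ι → D) (h : (ι → D) → M) :
    ∑ σ : Equiv.Perm ι, h (χ ∘ σ) = (∏ r, (fibreCount χ r).factorial) •
      ∑ φ ∈ univ.filter (fun φ : ι → D => fibreCount φ = fibreCount χ), h φ := by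
  rw [← Finset.sum_fiberwise (univ : Finset (Equiv.Perm ι)) (fun σ => χ ∘ σ), Finset.smul_sum,
    Finset.sum_filter]
  refine Finset.sum_congr rfl fun φ _ => ?_
  rw [Finset.sum_congr rfl (g := fun _ => h φ) (fun σ hσ => by rw [(mem_filter.1 hσ).2]),
    Finset.sum_const]
  split_ifs with hφ
  · congr 1
    obtain ⟨τ, rfl⟩ := exists_perm_of_fibreCount_eq hφ
    have h1 := DomMulAct.stabilizer_card χ
    rw [Fintype.card_subtype] at h1
    simp_rw [Fintype.card_subtype] at h1
    refine Eq.trans ?_ h1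
    refine Finset.card_bij' (fun σ _ => σ * τ⁻¹) (fun σ _ => σ * τ) ?_ ?_ ?_ ?_
    · intro σ hσ
      simp only [mem_filter, mem_univ, true_and] at hσ ⊢
      funext i
      have := congrFun hσ (τ⁻¹ i)
      simpa using this
    · intro σ hσ
      simp only [mem_filter, mem_univ, true_and] at hσ ⊢
      funext i
      exact congrFun hσ (τ i)
    · intro σ _; simp
    · intro σ _; simp
  · rw [Finset.card_eq_zero.2, zero_smul]
    refine Finset.filter_eq_empty_iff.2 fun σ _ hσ => hφ ?_
    subst hσ
    funext r
    unfold fibreCount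
    refine Finset.card_bij' (fun i _ => σ i) (fun i _ => σ.symm i) ?_ ?_ ?_ ?_ <;> simp

lemma card_fibreCount_eq_mul (χ : ι → D) :
    (∏ r, (fibreCount χ r).factorial) *
      (univ.filter (fun φ : ι → D => fibreCount φ = fibreCount χ)).card =
      (Fintype.card ι).factorial := by
  have := sum_perm_comp χ (fun _ => (1 : ℕ))
  simpa [Fintype.card_perm] using this.symm

end Counting

section PermanentBound

variable {ι G : Type*} [Fintype ι] [AddCommGroup G] [Fintype G]

lemma sum_norm_sq_charSum (z : AddChar G ℂ → ℂ) :
    ∑ g : G, ‖∑ r : AddChar G ℂ, z r * r g‖ ^ 2 = Fintype.card G * ∑ r, ‖z r‖ ^ 2 := by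
  have hn : ∀ z : ℂ, ((‖z‖ ^ 2 : ℝ) : ℂ) = z * conj z := by
    intro z; rw [Complex.mul_conj, Complex.normSq_eq_norm_sq]
  have orth : ∀ r s : AddChar G ℂ, ∑ g : G, r g * conj (s g) =
      if r = s then (Fintype.card G : ℂ) else 0 := by
    intro r s
    have : ∀ g : G, r g * conj (s g) = (r * s⁻¹) g := by
      intro g
      rw [AddChar.mul_apply, AddChar.inv_apply', ← AddChar.inv_apply_eq_conj]
    simp_rw [this]
    rw [AddChar.sum_eq_ite]
    exact if_congr (by rw [← AddChar.one_eq_zero, mul_inv_eq_one]) rfl rfl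
  have : ((∑ g : G, ‖∑ r : AddChar G ℂ, z r * r g‖ ^ 2 : ℝ) : ℂ) =
      ((Fintype.card G * ∑ r, ‖z r‖ ^ 2 : ℝ) : ℂ) := by
    rw [Complex.ofReal_sum, Complex.ofReal_mul, Complex.ofReal_sum]
    simp_rw [hn, map_sum, Finset.sum_mul_sum, map_mul]
    rw [Finset.sum_comm, Finset.mul_sum]
    refine Finset.sum_congr rfl fun r _ => ?_
    rw [Finset.sum_comm]
    have : ∀ s : AddChar G ℂ, ∑ g : G, z r * r g * (conj (z s) * conj (s g)) =
        z r * conj (z s) * if r = s then (Fintype.card G : ℂ) else 0 := by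
      intro s
      rw [← orth, Finset.mul_sum]
      exact Finset.sum_congr rfl fun g _ => by ring
    simp_rw [this]
    simp
    ring
  exact_mod_cast this

/-- Parseval says that the squared factors have mean `1`, so their product is at most `1`. -/
lemma prod_norm_charSum_le_one {z : AddChar G ℂ → ℂ} (hz : ∑ r, ‖z r‖ ^ 2 = 1) :
    ∏ g : G, ‖∑ r : AddChar G ℂ, z r * r g‖ ≤ 1 := by
  have h1 : (∏ g : G, ‖∑ r : AddChar G ℂ, z r * r g‖) ^ 2 ≤ 1 := by
    rw [← Finset.prod_pow]
    calc ∏ g : G, ‖∑ r : AddChar G ℂ, z r * r g‖ ^ 2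
        ≤ ∏ g : G, Real.exp (‖∑ r : AddChar G ℂ, z r * r g‖ ^ 2 - 1) := by
          refine Finset.prod_le_prod (fun _ _ => by positivity) fun g _ => ?_
          have := Real.add_one_le_exp (‖∑ r : AddChar G ℂ, z r * r g‖ ^ 2 - 1)
          linarith
      _ = 1 := by
          rw [← Real.exp_sum, Finset.sum_sub_distrib, sum_norm_sq_charSum, hz]
          simp
  exact (sq_le_one_iff₀ (Finset.prod_nonneg fun _ _ => norm_nonneg _)).1 h1

/-- A coefficient bound: the sum on the left is the coefficient of `∏ r, z r ^ fibreCount χ r` in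
`∏ i, ∑ r, z r * r (e i)`, a polynomial bounded by `1` on the torus `|z r| = x r`. The coefficient
is extracted with phases that are `N`-th roots of unity, where `N` exceeds the degree. -/
lemma norm_coeff_le_one (e : ι ≃ G) (χ : ι → AddChar G ℂ) {x : AddChar G ℂ → ℝ}
    (hx : ∑ r, x r ^ 2 = 1) (hx0 : ∀ r, 0 ≤ x r) :
    (∏ r, x r ^ fibreCount χ r) *
      ‖∑ φ ∈ univ.filter (fun φ : ι → AddChar G ℂ => fibreCount φ = fibreCount χ),
        ∏ i, φ i (e i)‖ ≤ 1 := by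
  set n := Fintype.card ι with hn
  let N := n + 1
  let ψ : AddChar (ZMod N) ℂ := ZMod.stdAddChar
  have hψ : ψ.IsPrimitive := ZMod.isPrimitive_stdAddChar N
  set T : ℝ := ((Fintype.card (AddChar G ℂ → ZMod N) : ℕ) : ℝ) with hT
  have hTpos : 0 < T := by
    rw [hT]; exact_mod_cast Fintype.card_pos
  -- Fibre counts are at most `n < N`, so they agree as soon as they agree modulo `N`.
  have hfinite : ∀ φ : ι → AddChar G ℂ,
      ∑ t : AddChar G ℂ → ZMod N, (∏ i, ψ (t (φ i))) * ∏ r, ψ (-(t r * fibreCount χ r)) =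
        if fibreCount φ = fibreCount χ then (T : ℂ) else 0 := by
    intro φ
    have h1 : ∀ t : AddChar G ℂ → ZMod N,
        (∏ i, ψ (t (φ i))) * ∏ r, ψ (-(t r * fibreCount χ r)) =
        ∏ r, ψ (t r * ((fibreCount φ r : ZMod N) - fibreCount χ r)) := by
      intro t
      rw [prod_comp_eq_prod_pow φ (fun r => ψ (t r)), ← Finset.prod_mul_distrib]
      refine Finset.prod_congr rfl fun r _ => ?_
      rw [← AddChar.map_nsmul_eq_pow, ← AddChar.map_add_eq_mul]
      congr 1
      rw [nsmul_eq_mul]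
      ring
    simp_rw [h1]
    have h2 := Finset.prod_univ_sum (fun _ : AddChar G ℂ => (univ : Finset (ZMod N)))
      (fun r x => ψ (x * ((fibreCount φ r : ZMod N) - fibreCount χ r)))
    rw [Fintype.piFinset_univ] at h2
    rw [← h2]
    simp_rw [AddChar.sum_mulShift _ hψ]
    split_ifs with h
    · simp [h, hT, Fintype.card_pi]
    · obtain ⟨r, hr⟩ := Function.ne_iff.1 h
      refine Finset.prod_eq_zero (mem_univ r) ?_
      rw [if_neg]
      · simp
      rw [sub_eq_zero, ZMod.natCast_eq_natCast_iff']
      rw [Nat.mod_eq_of_lt (Nat.lt_succ_of_le (fibreCount_le φ r)),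
        Nat.mod_eq_of_lt (Nat.lt_succ_of_le (fibreCount_le χ r))]
      exact hr
  -- Averaging the polynomial over all phases, against the inverse phase of the wanted monomial,
  -- extracts the coefficient.
  have hmain : ∑ t : AddChar G ℂ → ZMod N,
      (∏ i, ∑ r : AddChar G ℂ, (x r * ψ (t r)) * r (e i)) * ∏ r, ψ (-(t r * fibreCount χ r)) =
      T * ((∏ r, (x r : ℂ) ^ fibreCount χ r) *
        ∑ φ ∈ univ.filter (fun φ : ι → AddChar G ℂ => fibreCount φ = fibreCount χ),
          ∏ i, φ i (e i)) := by
    have h2 : ∀ t : AddChar G ℂ → ZMod N,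
        ∏ i, ∑ r : AddChar G ℂ, ((x r : ℂ) * ψ (t r)) * r (e i) =
        ∑ φ : ι → AddChar G ℂ, ∏ i, (((x (φ i) : ℂ) * ψ (t (φ i))) * φ i (e i)) := by
      intro t
      have := Finset.prod_univ_sum (fun _ : ι => (univ : Finset (AddChar G ℂ)))
        (fun i r => ((x r : ℂ) * ψ (t r)) * r (e i))
      rwa [Fintype.piFinset_univ] at this
    simp_rw [h2, Finset.sum_mul]
    rw [Finset.sum_comm, Finset.mul_sum, Finset.mul_sum, Finset.sum_filter]
    refine Finset.sum_congr rfl fun φ _ => ?_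
    have h3 : ∀ t : AddChar G ℂ → ZMod N,
        (∏ i, (((x (φ i) : ℂ) * ψ (t (φ i))) * φ i (e i))) * ∏ r, ψ (-(t r * fibreCount χ r)) =
        ((∏ i, (x (φ i) : ℂ)) * ∏ i, φ i (e i)) *
          ((∏ i, ψ (t (φ i))) * ∏ r, ψ (-(t r * fibreCount χ r))) := by
      intro t
      rw [Finset.prod_mul_distrib, Finset.prod_mul_distrib]
      ring
    simp_rw [h3]
    rw [← Finset.mul_sum, hfinite, prod_comp_eq_prod_pow φ (fun r => (x r : ℂ))]
    split_ifs with h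
    · rw [h]; ring
    · simp
  have hnorm := congrArg norm hmain
  rw [norm_mul, norm_mul, Complex.norm_real, Real.norm_of_nonneg hTpos.le, norm_prod] at hnorm
  have h4 : ∏ r, ‖(x r : ℂ) ^ fibreCount χ r‖ = ∏ r, x r ^ fibreCount χ r := by
    refine Finset.prod_congr rfl fun r _ => ?_
    rw [norm_pow, Complex.norm_real, Real.norm_of_nonneg (hx0 r)]
  rw [h4] at hnorm
  have h5 : ‖∑ t : AddChar G ℂ → ZMod N,
      (∏ i, ∑ r : AddChar G ℂ, (x r * ψ (t r)) * r (e i)) * ∏ r, ψ (-(t r * fibreCount χ r))‖ ≤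
      T := by
    refine (norm_sum_le _ _).trans ?_
    have : ∀ t ∈ (univ : Finset (AddChar G ℂ → ZMod N)),
        ‖(∏ i, ∑ r : AddChar G ℂ, (x r * ψ (t r)) * r (e i)) *
          ∏ r, ψ (-(t r * fibreCount χ r))‖ ≤ 1 := by
      intro t _
      rw [norm_mul, norm_prod, norm_prod]
      simp only [AddChar.norm_apply, Finset.prod_const_one, mul_one]
      rw [Equiv.prod_comp e (fun g => ‖∑ r : AddChar G ℂ, (x r * ψ (t r)) * r g‖)]
      refine prod_norm_charSum_le_one ?_
      rw [← hx]
      refine Finset.sum_congr rfl fun r _ => ?_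
      rw [norm_mul, AddChar.norm_apply, mul_one, Complex.norm_real, Real.norm_of_nonneg (hx0 r)]
    refine (Finset.sum_le_sum this).trans ?_
    rw [Finset.sum_const, card_univ, nsmul_eq_mul, mul_one]
  rw [hnorm] at h5
  exact le_of_mul_le_mul_left (by rw [mul_one]; exact h5) hTpos

/-- Square-root cancellation: with `a` the fibre counts of `χ`, the Fourier coefficient is at most
`∏ (a r)! / (n! * ∏ √(a r / n) ^ a r)`. -/
lemma norm_bijFourier_mul_le (hc : Fintype.card ι = Fintype.card G) (χ : ι → AddChar G ℂ) :
    ‖bijFourier χ‖ * ((Fintype.card ι).factorial *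
      ∏ r, √(fibreCount χ r / Fintype.card ι) ^ fibreCount χ r) ≤
      ∏ r, ((fibreCount χ r).factorial : ℝ) := by
  have e : ι ≃ G := Fintype.equivOfCardEq hc
  have hn0 : (0 : ℝ) < Fintype.card ι := by
    rw [hc]; exact_mod_cast Fintype.card_pos
  have hfac : ((Fintype.card ι).factorial : ℂ) ≠ 0 :=
    Nat.cast_ne_zero.2 (Nat.factorial_ne_zero _)
  have h1 : ((Fintype.card ι).factorial : ℂ) * bijFourier χ =
      (∏ r, (fibreCount χ r).factorial) •
      ∑ φ ∈ univ.filter (fun φ : ι → AddChar G ℂ => fibreCount φ = fibreCount χ),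
        ∏ i, φ i (e i) := by
    rw [← sum_perm_comp, bijFourier, mul_div_cancel₀ _ hfac]
    refine Fintype.sum_equiv (Equiv.equivCongr (Equiv.refl ι) e.symm |>.trans (Equiv.inv _)) _ _
      fun f => ?_
    refine Fintype.prod_equiv (f.trans e.symm) _ _ fun i => ?_
    simp [Equiv.Perm.inv_def, Equiv.equivCongr]
  have h2 := congrArg norm h1
  rw [norm_mul, Complex.norm_natCast, nsmul_eq_mul, norm_mul, Complex.norm_natCast] at h2
  have h3 := norm_coeff_le_one e χ (x := fun r => √(fibreCount χ r / Fintype.card ι))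
    (by
      have : ∀ r : AddChar G ℂ, √((fibreCount χ r : ℝ) / Fintype.card ι) ^ 2 =
          (fibreCount χ r : ℝ) / Fintype.card ι := fun r => Real.sq_sqrt (by positivity)
      simp_rw [this]
      rw [← Finset.sum_div, ← Nat.cast_sum, sum_fibreCount, div_self hn0.ne'])
    (fun r => Real.sqrt_nonneg _)
  calc _ = ((Fintype.card ι).factorial * ‖bijFourier χ‖) *
        ∏ r, √(fibreCount χ r / Fintype.card ι) ^ fibreCount χ r := by ring
    _ = (∏ r, (fibreCount χ r).factorial : ℕ) *
        ((∏ r, √(fibreCount χ r / Fintype.card ι) ^ fibreCount χ r) *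
          ‖∑ φ ∈ univ.filter (fun φ : ι → AddChar G ℂ => fibreCount φ = fibreCount χ),
            ∏ i, φ i (e i)‖) := by rw [h2]; ring
    _ ≤ (∏ r, (fibreCount χ r).factorial : ℕ) * 1 := by gcongr
    _ = _ := by push_cast; ring

end PermanentBound

/-! ### The contribution of spread tuples -/

section Weights

lemma exp_mul_pow_le (j : ℕ) :
    Real.exp 1 * (j : ℝ) ^ (j + 1) ≤ ((j : ℝ) + 1) ^ (j + 1) := by
  have h0 : (0 : ℝ) < j + 1 := by positivity
  have h1 : (j : ℝ) / (j + 1) ≤ Real.exp (-(1 / (j + 1))) := by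
    have := Real.add_one_le_exp (-(1 / ((j : ℝ) + 1)))
    refine le_trans (le_of_eq ?_) this
    field_simp
    ring
  have h2 : ((j : ℝ) / (j + 1)) ^ (j + 1) ≤ Real.exp (-1) := by
    refine (pow_le_pow_left₀ (by positivity) h1 _).trans (le_of_eq ?_)
    rw [← Real.exp_nat_mul]
    congr 1
    push_cast
    field_simp
  rw [div_pow, div_le_iff₀ (by positivity), Real.exp_neg, inv_mul_eq_div,
    le_div_iff₀ (Real.exp_pos 1)] at h2
  linarith

lemma factorial_le_of_pos {j : ℕ} (hj : 1 ≤ j) :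
    (j.factorial : ℝ) ≤ Real.exp 1 * j * (j / Real.exp 1) ^ j := by
  induction j, hj using Nat.le_induction with
  | base => simp
  | succ j hj ih =>
    rw [Nat.factorial_succ]
    push_cast
    calc ((j : ℝ) + 1) * j.factorial
        ≤ (j + 1) * (Real.exp 1 * j * (j / Real.exp 1) ^ j) := by gcongr
      _ = (j + 1) * (Real.exp 1 * (j : ℝ) ^ (j + 1)) / Real.exp 1 ^ j := by
          rw [div_pow]; ring
      _ ≤ (j + 1) * ((j : ℝ) + 1) ^ (j + 1) / Real.exp 1 ^ j := by
          gcongr; exact exp_mul_pow_le j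
      _ = _ := by
          rw [div_pow]; field_simp; ring

lemma factorial_le (j : ℕ) :
    (j.factorial : ℝ) ≤ Real.exp 1 * (j + 1) * (j / Real.exp 1) ^ j := by
  rcases Nat.eq_zero_or_pos j with rfl | hj
  · simp
  · refine (factorial_le_of_pos hj).trans ?_
    gcongr
    linarith

lemma div_exp_pow_le_factorial (n : ℕ) : ((n : ℝ) / Real.exp 1) ^ n ≤ n.factorial := by
  have h := Real.pow_div_factorial_le_exp (n : ℝ) (Nat.cast_nonneg n) n
  rw [div_le_iff₀ (by positivity)] at h
  rw [div_pow, div_le_iff₀ (by positivity), ← Real.exp_nat_mul, mul_one]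
  linarith

/-- The tilting parameter. It has to exceed `1`, to gain from the most frequent character not
occurring too often, and to be less than `√2`, to make the weights of the other characters
summable. -/
def tilt : ℝ := √(3 / 2)

lemma tilt_pos : 0 < tilt := Real.sqrt_pos.2 (by norm_num)

lemma one_lt_tilt : 1 < tilt := by
  rw [tilt, Real.lt_sqrt (by norm_num)]; norm_num

/-- The scale of the exponential tilt, chosen so that the tilted weight of `j` occurrences is about
`(tilt * √(j / n)) ^ j`. -/
def tiltScale (n : ℕ) : ℝ := tilt * Real.exp 1 ^ 2 / n ^ 2

/-- The contribution of a character occurring `j` times to the cubic sum over all tuples with given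
occurrence numbers, tilted by `tiltScale n ^ j`. -/
def orbitWeight (n j : ℕ) : ℝ :=
  (j.factorial : ℝ) ^ 2 / (√(j / n) ^ j) ^ 3 * tiltScale n ^ j

lemma tiltScale_pos {n : ℕ} (hn : 0 < n) : 0 < tiltScale n := by
  have : (0 : ℝ) < n := by exact_mod_cast hn
  have := tilt_pos
  unfold tiltScale
  positivity

lemma sqrt_div_pow_pos {n : ℕ} (hn : 0 < n) (j : ℕ) : 0 < √((j : ℝ) / n) ^ j := by
  rcases Nat.eq_zero_or_pos j with rfl | hj
  · simp
  · have : (0 : ℝ) < n := by exact_mod_cast hn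
    have : (0 : ℝ) < j := by exact_mod_cast hj
    positivity

lemma orbitWeight_nonneg {n : ℕ} (hn : 0 < n) (j : ℕ) : 0 ≤ orbitWeight n j := by
  have := tiltScale_pos hn
  unfold orbitWeight
  positivity

lemma orbitWeight_le {n : ℕ} (hn : 0 < n) (j : ℕ) :
    orbitWeight n j ≤ Real.exp 1 ^ 2 * (j + 1) ^ 2 * (tilt * √(j / n)) ^ j := by
  have hs := sqrt_div_pow_pos hn j
  have hy := tiltScale_pos hn
  have hn0 : (0 : ℝ) < n := by exact_mod_cast hn
  unfold orbitWeight
  calc _ ≤ (Real.exp 1 * (j + 1) * (j / Real.exp 1) ^ j) ^ 2 / (√(j / n) ^ j) ^ 3 *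
        tiltScale n ^ j := by
        gcongr
        exact factorial_le j
    _ = Real.exp 1 ^ 2 * (j + 1) ^ 2 * (((j / Real.exp 1) ^ j) ^ 2 * tiltScale n ^ j /
        (√(j / n) ^ j) ^ 3) := by ring
    _ = _ := by
        congr 1
        rw [div_eq_iff (by positivity), ← pow_mul, mul_comm j 2, pow_mul, ← mul_pow, ← pow_mul,
          mul_comm j 3, pow_mul, ← mul_pow]
        congr 1
        have h4 : √((j : ℝ) / n) ^ 4 = (j / n) ^ 2 := by
          rw [show 4 = 2 * 2 by norm_num, pow_mul, Real.sq_sqrt (by positivity)]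
        have : tilt * √((j : ℝ) / n) * √((j : ℝ) / n) ^ 3 = tilt * √((j : ℝ) / n) ^ 4 := by ring
        rw [this, h4, tiltScale]
        field_simp

lemma orbitWeight_le_of_le {n j : ℕ} (hn : 0 < n) (hj : j ≤ n) :
    orbitWeight n j ≤ Real.exp 1 ^ 2 * (n + 1) ^ 2 * tilt ^ j := by
  have hn0 : (0 : ℝ) < n := by exact_mod_cast hn
  have ht := tilt_pos
  have hjn : (j : ℝ) ≤ n := by exact_mod_cast hj
  refine (orbitWeight_le hn j).trans ?_
  have : √((j : ℝ) / n) ≤ 1 := by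
    rw [Real.sqrt_le_one, div_le_one hn0]; exact hjn
  gcongr
  exact mul_le_of_le_one_right ht.le this

/-- The weight restricted to `j ≤ n / 2`, the range available to every character but the most
frequent. -/
def smallWeight (n j : ℕ) : ℝ := if 2 * j ≤ n then orbitWeight n j else 0

lemma smallWeight_nonneg {n : ℕ} (hn : 0 < n) (j : ℕ) : 0 ≤ smallWeight n j := by
  unfold smallWeight
  split_ifs
  · exact orbitWeight_nonneg hn j
  · exact le_rfl

lemma smallWeight_zero (n : ℕ) : smallWeight n 0 = 1 := by simp [smallWeight, orbitWeight]

lemma smallWeight_succ_le {n : ℕ} (hn : 0 < n) (k : ℕ) :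
    smallWeight n (k + 1) ≤
      Real.exp 1 ^ 2 * tilt * ((k + 2) ^ 3 * √(3 / 4) ^ k) * (1 / √n) := by
  have hn0 : (0 : ℝ) < n := by exact_mod_cast hn
  have ht := tilt_pos
  unfold smallWeight
  split_ifs with h
  · refine (orbitWeight_le hn _).trans ?_
    -- One of the `k + 1` factors provides the decay in `n`, the others a geometric series.
    have hle : 2 * ((k : ℝ) + 1) ≤ n := by exact_mod_cast h
    have h1 : tilt * √(((k + 1 : ℕ) : ℝ) / n) ≤ √(3 / 4) := by
      rw [tilt, ← Real.sqrt_mul (by norm_num)]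
      refine Real.sqrt_le_sqrt ?_
      rw [← mul_div_assoc, div_le_iff₀ hn0]
      push_cast
      linarith
    have h2 : √(((k + 1 : ℕ) : ℝ) / n) ≤ (k + 2) * (1 / √n) := by
      rw [Real.sqrt_div (by positivity), div_eq_mul_one_div]
      refine mul_le_mul_of_nonneg_right ?_ (by positivity)
      rw [Real.sqrt_le_left (by positivity)]
      push_cast
      nlinarith [(Nat.cast_nonneg k : (0 : ℝ) ≤ k)]
    rw [pow_succ' (tilt * √(((k + 1 : ℕ) : ℝ) / n))]
    calc _ ≤ Real.exp 1 ^ 2 * (((k + 1 : ℕ) : ℝ) + 1) ^ 2 *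
          (tilt * ((k + 2) * (1 / √n)) * √(3 / 4) ^ k) := by gcongr
      _ = _ := by push_cast; ring
  · positivity

lemma summable_add_two_pow_mul {τ : ℝ} (h0 : 0 < τ) (h1 : τ < 1) :
    Summable fun k : ℕ => ((k : ℝ) + 2) ^ 3 * τ ^ k := by
  have hlt : ‖τ‖ < 1 := by rwa [Real.norm_of_nonneg h0.le]
  have h2 := (summable_nat_add_iff (f := fun k : ℕ => (k : ℝ) ^ 3 * τ ^ k) 2).2
    (summable_pow_mul_geometric_of_norm_lt_one 3 hlt)
  refine (h2.mul_right (τ ^ 2)⁻¹).congr fun k => ?_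
  push_cast
  field_simp
  ring

lemma exists_sum_smallWeight_le : ∃ K : ℝ, 0 ≤ K ∧ ∀ n : ℕ, 0 < n →
    ∑ j ∈ range (n + 1), smallWeight n j ≤ 1 + K / √n := by
  have ht := tilt_pos
  have hs := summable_add_two_pow_mul (τ := √(3 / 4)) (Real.sqrt_pos.2 (by norm_num))
    (by rw [Real.sqrt_lt' (by norm_num)]; norm_num)
  refine ⟨Real.exp 1 ^ 2 * tilt * ∑' k : ℕ, ((k : ℝ) + 2) ^ 3 * √(3 / 4 : ℝ) ^ k,
    mul_nonneg (by positivity) (tsum_nonneg fun k => by positivity), fun n hn => ?_⟩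
  rw [Finset.sum_range_succ', smallWeight_zero, add_comm]
  refine add_le_add_right ?_ 1
  refine (Finset.sum_le_sum fun k _ => smallWeight_succ_le hn k).trans ?_
  rw [← Finset.sum_mul, ← Finset.mul_sum, ← div_eq_mul_one_div]
  have := hs.sum_le_tsum (range n) (fun k _ => by positivity)
  exact div_le_div_of_nonneg_right (mul_le_mul_of_nonneg_left this (by positivity))
    (Real.sqrt_nonneg _)

end Weights

section SpreadCharacters

variable {ι G : Type*} [Fintype ι] [AddCommGroup G] [Fintype G]

/-- The tuples in which every character occurs fewer than `n - M` times. -/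
def spreadTuples (ι G : Type*) [Fintype ι] [AddCommGroup G] [Fintype G] (M : ℕ) :
    Finset (ι → AddChar G ℂ) :=
  univ.filter fun χ => ∀ ρ, fibreCount χ ρ + M < Fintype.card ι

lemma sum_prod_orbitWeight_le {D : Type*} [Fintype D] [Nonempty D] {n M : ℕ} (hn : 0 < n)
    (hD : Fintype.card D = n) {K : ℝ} (hK : 0 ≤ K)
    (hKn : ∑ j ∈ range (n + 1), smallWeight n j ≤ 1 + K / √n) (I : Finset (D → ℕ))
    (hI : ∀ a ∈ I, (∑ r, a r = n) ∧ ∀ r, a r + M < n) :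
    ∑ a ∈ I, ∏ r, orbitWeight n (a r) ≤
      n * (n + 1) * (Real.exp 1 ^ 2 * (n + 1) ^ 2) * tilt ^ n / tilt ^ (M + 1) *
        Real.exp (K * √n) := by
  have hn0 : (0 : ℝ) < n := by exact_mod_cast hn
  have ht := tilt_pos
  set B : ℝ := Real.exp 1 ^ 2 * (n + 1) ^ 2 * (tilt ^ n / tilt ^ (M + 1)) with hB
  have hB0 : 0 ≤ B := by positivity
  -- The factor of the dominant index `r₀` is bounded by `B` and replaced by `1`.
  let g : D → D → ℕ → ℝ := fun r₀ r j => if r = r₀ then 1 else smallWeight n j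
  have hg0 : ∀ r₀ r j, 0 ≤ g r₀ r j := by
    intro r₀ r j
    simp only [g]
    split_ifs
    · norm_num
    · exact smallWeight_nonneg hn j
  -- the most frequent value is treated separately; all others occur at most `n / 2` times
  have hpt : ∀ a ∈ I, ∏ r, orbitWeight n (a r) ≤ ∑ r₀, B * ∏ r, g r₀ r (a r) := by
    intro a ha
    obtain ⟨hsum, hbd⟩ := hI a ha
    obtain ⟨r₀, hr₀⟩ := Finite.exists_max a
    refine le_trans ?_ (Finset.single_le_sum (f := fun r₀ => B * ∏ r, g r₀ r (a r))
      (fun r₁ _ => mul_nonneg hB0 (Finset.prod_nonneg fun r _ => hg0 _ _ _)) (mem_univ r₀))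
    rw [← Finset.mul_prod_erase univ _ (mem_univ r₀),
      ← Finset.mul_prod_erase univ (fun r => g r₀ r (a r)) (mem_univ r₀)]
    have e1 : g r₀ r₀ (a r₀) = 1 := by simp [g]
    rw [e1, one_mul]
    refine mul_le_mul ?_ (le_of_eq ?_) (Finset.prod_nonneg fun r _ => orbitWeight_nonneg hn _) hB0
    · have hle : a r₀ ≤ n := by have := hbd r₀; omega
      refine (orbitWeight_le_of_le hn hle).trans ?_
      rw [hB]
      refine mul_le_mul_of_nonneg_left ?_ (by positivity)
      rw [le_div_iff₀ (by positivity), ← pow_add]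
      exact pow_le_pow_right₀ one_lt_tilt.le (by have := hbd r₀; omega)
    · refine Finset.prod_congr rfl fun r hr => ?_
      have hne := (mem_erase.1 hr).1
      have h2 : a r + a r₀ ≤ n := by
        rw [← hsum, ← Finset.add_sum_erase univ a (mem_univ r₀), add_comm]
        exact Nat.add_le_add_left
          (Finset.single_le_sum (f := a) (fun _ _ => Nat.zero_le _) hr) _
      have h3 : 2 * a r ≤ n := by have := hr₀ r; omega
      simp [g, hne, smallWeight, h3]
  have hsub : I ⊆ Fintype.piFinset (fun _ : D => range (n + 1)) := by
    intro a ha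
    rw [Fintype.mem_piFinset]
    intro r
    have := (hI a ha).2 r
    rw [mem_range]; omega
  calc ∑ a ∈ I, ∏ r, orbitWeight n (a r)
      ≤ ∑ a ∈ I, ∑ r₀, B * ∏ r, g r₀ r (a r) := Finset.sum_le_sum hpt
    _ ≤ ∑ a ∈ Fintype.piFinset (fun _ : D => range (n + 1)), ∑ r₀, B * ∏ r, g r₀ r (a r) := by
        refine Finset.sum_le_sum_of_subset_of_nonneg hsub fun a _ _ => ?_
        exact Finset.sum_nonneg fun r₀ _ =>
          mul_nonneg hB0 (Finset.prod_nonneg fun r _ => hg0 _ _ _)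
    _ = ∑ r₀ : D, B * ∏ r, ∑ j ∈ range (n + 1), g r₀ r j := by
        rw [Finset.sum_comm]
        refine Finset.sum_congr rfl fun r₀ _ => ?_
        rw [← Finset.mul_sum, Finset.prod_univ_sum]
    _ ≤ ∑ r₀ : D, B * ((n + 1) * Real.exp (K * √n)) := by
        refine Finset.sum_le_sum fun r₀ _ => mul_le_mul_of_nonneg_left ?_ hB0
        rw [← Finset.mul_prod_erase univ _ (mem_univ r₀)]
        have e1 : ∑ j ∈ range (n + 1), g r₀ r₀ j = n + 1 := by simp [g]
        rw [e1]
        refine mul_le_mul_of_nonneg_left ?_ (by positivity)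
        have h4 : ∀ r ∈ univ.erase r₀, ∑ j ∈ range (n + 1), g r₀ r j ≤ Real.exp (K / √n) := by
          intro r hr
          have hne := (mem_erase.1 hr).1
          simp only [g, hne, if_false]
          refine hKn.trans ?_
          rw [add_comm]
          exact Real.add_one_le_exp _
        refine (Finset.prod_le_prod (fun r _ => Finset.sum_nonneg fun j _ => hg0 _ _ _) h4).trans ?_
        rw [Finset.prod_const, card_erase_of_mem (mem_univ r₀), card_univ, hD, ← Real.exp_nat_mul]
        refine Real.exp_le_exp.2 ?_
        have h5 : ((n - 1 : ℕ) : ℝ) ≤ n := by exact_mod_cast Nat.sub_le n 1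
        calc ((n - 1 : ℕ) : ℝ) * (K / √n) ≤ n * (K / √n) := by gcongr
          _ = K * √n := by
            rw [mul_div_assoc', mul_comm, mul_div_assoc, Real.div_sqrt]
    _ = _ := by
        rw [Finset.sum_const, card_univ, hD, nsmul_eq_mul, hB]
        ring

/-- The sum over spread tuples, grouped by occurrence numbers: each group has `n! / ∏ (a r)!`
members, all subject to the same bound `norm_bijFourier_mul_le`. -/
lemma sum_spreadTuples_le (hc : Fintype.card ι = Fintype.card G) {K : ℝ} (hK : 0 ≤ K)
    (hKn : ∑ j ∈ range (Fintype.card ι + 1), smallWeight (Fintype.card ι) j ≤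
      1 + K / √(Fintype.card ι)) (M : ℕ) :
    ∑ χ ∈ spreadTuples ι G M, ‖bijFourier χ‖ ^ 3 ≤
      (Fintype.card ι) * ((Fintype.card ι) + 1) *
        (Real.exp 1 ^ 2 * ((Fintype.card ι) + 1) ^ 2) / tilt ^ (M + 1) *
        Real.exp (K * √(Fintype.card ι)) := by
  set n := Fintype.card ι with hndef
  have hn : 0 < n := by rw [hc]; exact Fintype.card_pos
  have hn0 : (0 : ℝ) < n := by exact_mod_cast hn
  have hy := tiltScale_pos hn
  have ht := tilt_pos
  have hfac : (0 : ℝ) < n.factorial := by exact_mod_cast Nat.factorial_pos n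
  let Q : (AddChar G ℂ → ℕ) → ℝ := fun a => ∏ r, √(a r / n) ^ a r
  let P : (AddChar G ℂ → ℕ) → ℝ := fun a => ∏ r, ((a r).factorial : ℝ)
  have hQ : ∀ a, 0 < Q a := fun a => Finset.prod_pos fun r _ => sqrt_div_pow_pos hn _
  have hP : ∀ a, 0 < P a := fun a =>
    Finset.prod_pos fun r _ => by exact_mod_cast Nat.factorial_pos _
  have h1 : ∀ χ ∈ spreadTuples ι G M, ‖bijFourier χ‖ ^ 3 ≤
      (P (fibreCount χ) / (n.factorial * Q (fibreCount χ))) ^ 3 := by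
    intro χ _
    refine pow_le_pow_left₀ (norm_nonneg _) ?_ 3
    rw [le_div_iff₀ (mul_pos hfac (hQ _))]
    exact norm_bijFourier_mul_le hc χ
  refine (Finset.sum_le_sum h1).trans ?_
  rw [Finset.sum_comp (fun a => (P a / (n.factorial * Q a)) ^ 3) (fun χ => fibreCount χ)]
  have h2 : ∀ a ∈ (spreadTuples ι G M).image (fun χ => fibreCount χ),
      ((spreadTuples ι G M).filter (fun χ => fibreCount χ = a)).card •
        (P a / (n.factorial * Q a)) ^ 3 ≤
      (1 / (n.factorial ^ 2 * tiltScale n ^ n)) * ∏ r, orbitWeight n (a r) := by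
    intro a ha
    obtain ⟨χ, _, rfl⟩ := mem_image.1 ha
    have hcard : (((spreadTuples ι G M).filter
        (fun φ => fibreCount φ = fibreCount χ)).card : ℝ) ≤ n.factorial / P (fibreCount χ) := by
      rw [le_div_iff₀ (hP _), mul_comm]
      have := card_fibreCount_eq_mul χ
      have h3 : ((spreadTuples ι G M).filter (fun φ => fibreCount φ = fibreCount χ)).card ≤
        (univ.filter (fun φ : ι → AddChar G ℂ => fibreCount φ = fibreCount χ)).card :=
        Finset.card_le_card (filter_subset_filter _ (subset_univ _))
      have h4 := Nat.mul_le_mul_left (∏ r, (fibreCount χ r).factorial) h3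
      rw [this] at h4
      simp only [P]
      exact_mod_cast h4
    have hprod : ∏ r, orbitWeight n (fibreCount χ r) =
        P (fibreCount χ) ^ 2 / Q (fibreCount χ) ^ 3 * tiltScale n ^ n := by
      simp only [orbitWeight, P, Q]
      rw [Finset.prod_mul_distrib, Finset.prod_div_distrib, Finset.prod_pow, Finset.prod_pow,
        Finset.prod_pow_eq_pow_sum, sum_fibreCount]
    rw [nsmul_eq_mul, hprod]
    have hPχ := hP (fibreCount χ)
    have hQχ := hQ (fibreCount χ)
    refine (mul_le_mul_of_nonneg_right hcard (by positivity)).trans (le_of_eq ?_)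
    field_simp
  refine (Finset.sum_le_sum h2).trans ?_
  rw [← Finset.mul_sum]
  have h5 := sum_prod_orbitWeight_le (D := AddChar G ℂ) (M := M) hn
    (by rw [AddChar.card_eq, ← hc]) hK hKn
    ((spreadTuples ι G M).image (fun χ => fibreCount χ)) (by
      intro a ha
      obtain ⟨χ, hχ, rfl⟩ := mem_image.1 ha
      exact ⟨sum_fibreCount χ, (mem_filter.1 hχ).2⟩)
  refine (mul_le_mul_of_nonneg_left h5 (by positivity)).trans ?_
  -- the lower Stirling bound absorbs the normalisation
  have h6 : tilt ^ n / (n.factorial ^ 2 * tiltScale n ^ n) ≤ 1 := by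
    have h7 := div_exp_pow_le_factorial n
    have h8 : tilt ^ n = (((n : ℝ) / Real.exp 1) ^ n) ^ 2 * tiltScale n ^ n := by
      rw [← pow_mul, mul_comm n 2, pow_mul, ← mul_pow, tiltScale]
      congr 1
      field_simp
    rw [div_le_one (by positivity), h8]
    gcongr
  have h9 : (0 : ℝ) ≤ n * (n + 1) * (Real.exp 1 ^ 2 * (n + 1) ^ 2) / tilt ^ (M + 1) *
      Real.exp (K * √n) := by positivity
  calc _ = tilt ^ n / (n.factorial ^ 2 * tiltScale n ^ n) *
        (n * (n + 1) * (Real.exp 1 ^ 2 * (n + 1) ^ 2) / tilt ^ (M + 1) *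
          Real.exp (K * √n)) := by ring
    _ ≤ _ := mul_le_of_le_one_left h9 h6

end SpreadCharacters

/-! ### The circle method identity and the uniform limit -/

section CircleMethod

variable {ι G : Type*} [Fintype ι] [AddCommGroup G]

lemma fibreCount_one_add_card_charSupport (χ : ι → AddChar G ℂ) :
    fibreCount χ 1 + (charSupport χ).card = Fintype.card ι := by
  unfold fibreCount charSupport
  exact card_filter_add_card_filter_not (s := univ) (fun i => χ i = 1)

lemma fibreCount_const_mul (ρ : AddChar G ℂ) (χ : ι → AddChar G ℂ) :
    fibreCount (fun i => ρ * χ i) ρ = fibreCount χ 1 := by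
  unfold fibreCount
  simp

variable [Fintype G]

/-- Orthogonality of characters turns the sum of cubes into a count of triples of bijections with
sum zero. -/
lemma sum_bijFourier_cube (hc : Fintype.card ι = Fintype.card G) :
    ((Fintype.card ι).factorial : ℂ) ^ 3 * ∑ χ : ι → AddChar G ℂ, bijFourier χ ^ 3 =
      (Fintype.card ι : ℂ) ^ (Fintype.card ι) *
        (Set.ncard {t : (ι ≃ G) × (ι ≃ G) × (ι ≃ G) |
          ∀ i, t.1 i + (t.2.1 i + t.2.2 i) = 0} : ℂ) := by
  have hfac : ((Fintype.card ι).factorial : ℂ) ≠ 0 :=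
    Nat.cast_ne_zero.2 (Nat.factorial_ne_zero _)
  have h1 : ∀ χ : ι → AddChar G ℂ, ((Fintype.card ι).factorial : ℂ) ^ 3 * bijFourier χ ^ 3 =
      ∑ t : (ι ≃ G) × (ι ≃ G) × (ι ≃ G), ∏ i, χ i (t.1 i + (t.2.1 i + t.2.2 i)) := by
    intro χ
    rw [← mul_pow, bijFourier, mul_div_cancel₀ _ hfac, pow_succ', pow_two, Fintype.sum_prod_type,
      Finset.sum_mul_sum, Finset.sum_mul]
    refine Finset.sum_congr rfl fun e _ => ?_
    rw [Fintype.sum_prod_type, Finset.mul_sum]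
    refine Finset.sum_congr rfl fun e' _ => ?_
    rw [Finset.mul_sum]
    refine Finset.sum_congr rfl fun e'' _ => ?_
    simp_rw [AddChar.map_add_eq_mul, Finset.prod_mul_distrib]
  rw [Finset.mul_sum]
  simp_rw [h1]
  rw [Finset.sum_comm]
  have h2 : ∀ t : (ι ≃ G) × (ι ≃ G) × (ι ≃ G),
      ∑ χ : ι → AddChar G ℂ, ∏ i, χ i (t.1 i + (t.2.1 i + t.2.2 i)) =
      if ∀ i, t.1 i + (t.2.1 i + t.2.2 i) = 0 then
        (Fintype.card ι : ℂ) ^ (Fintype.card ι) else 0 := by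
    intro t
    have := Finset.prod_univ_sum (fun _ : ι => (univ : Finset (AddChar G ℂ)))
      (fun i r => r (t.1 i + (t.2.1 i + t.2.2 i)))
    rw [Fintype.piFinset_univ] at this
    rw [← this]
    simp_rw [AddChar.sum_apply_eq_ite]
    split_ifs with h
    · simp [h, hc]
    · push Not at h
      obtain ⟨i, hi⟩ := h
      exact Finset.prod_eq_zero (mem_univ i) (if_neg hi)
  simp_rw [h2]
  rw [← Finset.sum_filter, Finset.sum_const, nsmul_eq_mul, mul_comm]
  congr 2
  rw [← Set.ncard_coe_finset]
  congr 1
  ext t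
  simp

/-- Negating the third bijection turns triples with sum zero into additive triples. -/
lemma ncard_triples (ι G : Type*) [Finite ι] [AddCommGroup G] [Finite G] :
    Set.ncard {t : (ι ≃ G) × (ι ≃ G) × (ι ≃ G) | ∀ i, t.1 i + (t.2.1 i + t.2.2 i) = 0} =
      Set.ncard {p : (ι → G) × (ι → G) |
        Function.Bijective p.1 ∧ Function.Bijective p.2 ∧ Function.Bijective (p.1 + p.2)} := by
  refine Set.ncard_congr (fun t _ => ((t.1 : ι → G), (t.2.1 : ι → G))) ?_ ?_ ?_
  · rintro ⟨e, e', e''⟩ h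
    refine ⟨e.bijective, e'.bijective, ?_⟩
    have : (e : ι → G) + (e' : ι → G) = (Equiv.neg G) ∘ e'' := by
      funext i
      have := h i
      simp only [← add_assoc] at this
      simpa using eq_neg_of_add_eq_zero_left this
    change Function.Bijective ((e : ι → G) + (e' : ι → G))
    rw [this]
    exact (Equiv.neg G).bijective.comp e''.bijective
  · rintro ⟨e, e', e''⟩ ⟨f, f', f''⟩ h h' heq
    simp only [Prod.mk.injEq, DFunLike.coe_fn_eq] at heq
    obtain ⟨rfl, rfl⟩ := heq
    simp only [Prod.mk.injEq, true_and]
    ext i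
    have h1 := h i
    have h2 := h' i
    exact add_left_cancel (add_left_cancel (h1.trans h2.symm))
  · rintro ⟨f, g⟩ ⟨hf, hg, hfg⟩
    refine ⟨(Equiv.ofBijective f hf, Equiv.ofBijective g hg,
      (Equiv.ofBijective _ hfg).trans (Equiv.neg G)), ?_, ?_⟩
    · intro i
      simp only [Equiv.ofBijective_apply, Equiv.trans_apply, Equiv.neg_apply, Pi.add_apply]
      abel
    · rfl

lemma sparseCubeSum_eq (m : ℕ) : sparseCubeSum ι G m =
    ∑ χ ∈ univ.filter (fun χ : ι → AddChar G ℂ => (charSupport χ).card = m),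
      bijFourier χ ^ 3 := by
  unfold sparseCubeSum supportCubeSum
  rw [← Finset.sum_fiberwise_of_maps_to (t := (univ : Finset ι).powersetCard m)
    (g := charSupport)]
  · refine Finset.sum_congr rfl fun A hA => Finset.sum_congr ?_ fun _ _ => rfl
    ext χ
    simp only [mem_withSupport, mem_filter, mem_univ, true_and]
    refine ⟨fun h => ⟨h ▸ (mem_powersetCard.1 hA).2, h⟩, fun h => h.2⟩
  · intro χ hχ
    exact mem_powersetCard.2 ⟨subset_univ _, (mem_filter.1 hχ).2⟩

lemma sum_concentrated (M : ℕ) :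
    ∑ χ : ι → AddChar G ℂ, (if Fintype.card ι ≤ fibreCount χ 1 + M then bijFourier χ ^ 3 else 0) =
      ∑ m ∈ range (M + 1), sparseCubeSum ι G m := by
  simp_rw [sparseCubeSum_eq, Finset.sum_filter]
  rw [Finset.sum_comm]
  refine Finset.sum_congr rfl fun χ _ => ?_
  rw [Finset.sum_ite_eq]
  refine if_congr ?_ rfl rfl
  rw [mem_range]
  have := fibreCount_one_add_card_charSupport χ
  omega

lemma fibreCount_add_le {χ : ι → AddChar G ℂ} {ρ ρ' : AddChar G ℂ} (h : ρ ≠ ρ') :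
    fibreCount χ ρ + fibreCount χ ρ' ≤ Fintype.card ι := by
  rw [← sum_fibreCount χ, ← Finset.add_sum_erase univ _ (mem_univ ρ)]
  exact Nat.add_le_add_left (Finset.single_le_sum (f := fibreCount χ) (fun _ _ => Nat.zero_le _)
    (mem_erase.2 ⟨h.symm, mem_univ _⟩)) _

/-- A tuple that is not spread has exactly one dominant character `ρ`. Multiplying by `ρ⁻¹` makes it
sparse without changing the coefficient, so each of the `n` characters contributes equally. -/
lemma sum_bijFourier_cube_split (hc : Fintype.card ι = Fintype.card G)
    (hodd : Odd (Fintype.card G)) {M : ℕ} (hM : 2 * M < Fintype.card ι) :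
    ∑ χ : ι → AddChar G ℂ, bijFourier χ ^ 3 =
      (Fintype.card ι : ℂ) * ∑ m ∈ range (M + 1), sparseCubeSum ι G m +
        ∑ χ ∈ spreadTuples ι G M, bijFourier χ ^ 3 := by
  set n := Fintype.card ι
  have h1 : ∀ χ : ι → AddChar G ℂ, bijFourier χ ^ 3 =
      (∑ ρ, if n ≤ fibreCount χ ρ + M then bijFourier χ ^ 3 else 0) +
        if (∀ ρ, fibreCount χ ρ + M < n) then bijFourier χ ^ 3 else 0 := by
    intro χ
    split_ifs with h
    · rw [Finset.sum_eq_zero, zero_add]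
      intro ρ _
      rw [if_neg (by have := h ρ; omega)]
    · push Not at h
      obtain ⟨ρ, hρ⟩ := h
      rw [Finset.sum_eq_single ρ, if_pos hρ, add_zero]
      · intro ρ' _ hne
        rw [if_neg]
        have : fibreCount χ ρ' + fibreCount χ ρ ≤ n := fibreCount_add_le hne
        omega
      · intro h; exact absurd (mem_univ ρ) h
  rw [Finset.sum_congr rfl fun χ _ => h1 χ, Finset.sum_add_distrib, spreadTuples,
    Finset.sum_filter]
  congr 1
  rw [Finset.sum_comm]
  have h2 : ∀ ρ : AddChar G ℂ, ∑ χ : ι → AddChar G ℂ,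
      (if n ≤ fibreCount χ ρ + M then bijFourier χ ^ 3 else 0) =
      ∑ m ∈ range (M + 1), sparseCubeSum ι G m := by
    intro ρ
    rw [← sum_concentrated]
    symm
    refine Fintype.sum_equiv (Equiv.piCongrRight fun _ => Equiv.mulLeft ρ) _ _ fun χ => ?_
    have e : (Equiv.piCongrRight fun _ : ι => Equiv.mulLeft ρ) χ = fun i => ρ * χ i := rfl
    rw [e, fibreCount_const_mul, bijFourier_const_mul hodd]
  rw [Finset.sum_congr rfl fun ρ _ => h2 ρ, Finset.sum_const, card_univ, AddChar.card_eq, ← hc,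
    nsmul_eq_mul]

end CircleMethod

section Asymptotics

lemma limitCoeff_even (k : ℕ) : limitCoeff (2 * k) = (-1 / 2 : ℝ) ^ k / k.factorial := by
  induction k with
  | zero => simp [limitCoeff]
  | succ k ih =>
    rw [show 2 * (k + 1) = 2 * k + 2 by ring, limitCoeff, ih, Nat.factorial_succ, pow_succ]
    push_cast
    field_simp

lemma limitCoeff_odd (k : ℕ) : limitCoeff (2 * k + 1) = 0 := by
  induction k with
  | zero => simp [limitCoeff]
  | succ k ih =>
    rw [show 2 * (k + 1) + 1 = (2 * k + 1) + 2 by ring, limitCoeff, ih]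
    simp

lemma hasSum_limitCoeff : HasSum limitCoeff (Real.exp (-1 / 2)) := by
  have he : HasSum (fun k => limitCoeff (2 * k)) (Real.exp (-1 / 2)) := by
    simp_rw [limitCoeff_even]
    have := NormedSpace.expSeries_div_hasSum_exp (-1 / 2 : ℝ)
    rwa [← Real.exp_eq_exp_ℝ] at this
  have ho : HasSum (fun k => limitCoeff (2 * k + 1)) 0 := by
    simp_rw [limitCoeff_odd]
    exact hasSum_zero
  simpa using he.even_add_odd ho

lemma tendsto_descFactorial_div_pow (m : ℕ) :
    Tendsto (fun n : ℕ => (n.descFactorial m : ℝ) / (n : ℝ) ^ m) atTop (𝓝 1) := by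
  induction m with
  | zero => simp
  | succ m ih =>
    have h1 : Tendsto (fun n : ℕ => 1 - (m : ℝ) / n) atTop (𝓝 1) := by
      simpa using (tendsto_const_nhds (x := (1 : ℝ))).sub
        (tendsto_const_div_atTop_nhds_zero_nat (m : ℝ))
    have h2 := h1.mul ih
    rw [one_mul] at h2
    refine h2.congr' ?_
    filter_upwards [eventually_ge_atTop (m + 1)] with n hn
    have hn0 : (n : ℝ) ≠ 0 := Nat.cast_ne_zero.2 (by omega)
    rw [Nat.descFactorial_succ, Nat.cast_mul, Nat.cast_sub (by omega)]
    field_simp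
    ring

/-- Dominated convergence for the sum of the sparse contributions, uniform in the group: the
convergence is along a filter on pairs of an order `n` and a sequence `B` obeying the two bounds. -/
lemma uniform_sum_limit (C : ℕ → ℝ) {ε : ℝ} (hε : 0 < ε) : ∃ N : ℕ, ∀ n ≥ N, ∀ B : ℕ → ℂ,
    (∀ m, 256 * m ≤ n → ‖B m‖ ≤ √(24 / 25) ^ m) →
    (∀ m, 256 * m ≤ n →
      ‖B m - (((n.descFactorial m : ℝ) / n ^ m * limitCoeff m : ℝ) : ℂ)‖ ≤ C m / √n) →
    ‖∑ m ∈ range (n / 256 + 1), B m - (Real.exp (-1 / 2) : ℂ)‖ < ε := by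
  -- The bounds are imposed through a principal filter, so that no family of groups has to be
  -- indexed.
  let good : Set (ℕ × (ℕ → ℂ)) := {p | (∀ m, 256 * m ≤ p.1 → ‖p.2 m‖ ≤ √(24 / 25) ^ m) ∧
    ∀ m, 256 * m ≤ p.1 →
      ‖p.2 m - (((p.1.descFactorial m : ℝ) / p.1 ^ m * limitCoeff m : ℝ) : ℂ)‖ ≤ C m / √p.1}
  let 𝓕 : Filter (ℕ × (ℕ → ℂ)) := comap Prod.fst atTop ⊓ 𝓟 good
  have hfst : Tendsto (Prod.fst : ℕ × (ℕ → ℂ) → ℕ) 𝓕 atTop := tendsto_comap.mono_left inf_le_left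
  have hgood : ∀ᶠ p in 𝓕, p ∈ good := (eventually_principal.2 fun _ h => h).filter_mono inf_le_right
  have hlt : √(24 / 25 : ℝ) < 1 := by rw [Real.sqrt_lt' (by norm_num)]; norm_num
  have key : Tendsto (fun p : ℕ × (ℕ → ℂ) => ∑' m, if m ∈ range (p.1 / 256 + 1) then p.2 m else 0)
      𝓕 (𝓝 (∑' m, (limitCoeff m : ℂ))) := by
    refine tendsto_tsum_of_dominated_convergence (bound := fun m => √(24 / 25 : ℝ) ^ m)
      (summable_geometric_of_lt_one (Real.sqrt_nonneg _) hlt) ?_ ?_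
    · intro m
      have h1 : Tendsto (fun p : ℕ × (ℕ → ℂ) => p.2 m) 𝓕 (𝓝 (limitCoeff m : ℂ)) := by
        have h2 : Tendsto (fun n : ℕ =>
            (((n.descFactorial m : ℝ) / (n : ℝ) ^ m * limitCoeff m : ℝ) : ℂ)) atTop
            (𝓝 (limitCoeff m : ℂ)) := by
          have := (tendsto_descFactorial_div_pow m).mul_const (limitCoeff m)
          rw [one_mul] at this
          exact (Complex.continuous_ofReal.tendsto _).comp this
        have h3 : Tendsto (fun n : ℕ => C m / √(n : ℝ)) atTop (𝓝 0) :=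
          tendsto_const_nhds.div_atTop
            (Real.tendsto_sqrt_atTop.comp tendsto_natCast_atTop_atTop)
        have h4 : Tendsto (fun p : ℕ × (ℕ → ℂ) =>
            p.2 m - (((p.1.descFactorial m : ℝ) / (p.1 : ℝ) ^ m * limitCoeff m : ℝ) : ℂ)) 𝓕
            (𝓝 0) := by
          refine squeeze_zero_norm' ?_ (h3.comp hfst)
          filter_upwards [hgood, hfst.eventually_ge_atTop (256 * m)] with p hp hpn
          exact hp.2 m hpn
        have h5 := h4.add (h2.comp hfst)
        rw [zero_add] at h5
        refine h5.congr fun p => ?_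
        simp
      refine h1.congr' ?_
      filter_upwards [hfst.eventually_ge_atTop (256 * m)] with p hpn
      rw [if_pos]
      rw [mem_range]; omega
    · filter_upwards [hgood] with p hp m
      split_ifs with hm
      · rw [mem_range] at hm
        exact hp.1 m (by omega)
      · rw [norm_zero]; positivity
  have hlim : ∑' m, (limitCoeff m : ℂ) = (Real.exp (-1 / 2) : ℂ) :=
    (Complex.hasSum_ofReal.2 hasSum_limitCoeff).tsum_eq
  rw [hlim] at key
  have hev := (Metric.tendsto_nhds.1 key) ε hε
  rw [eventually_inf_principal, eventually_comap, eventually_atTop] at hev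
  obtain ⟨N, hN⟩ := hev
  refine ⟨N, fun n hn B h1 h2 => ?_⟩
  have := hN n hn (n, B) rfl ⟨h1, h2⟩
  rw [dist_eq_norm, tsum_eq_sum (s := range (n / 256 + 1)) (fun m hm => if_neg hm)] at this
  rwa [Finset.sum_congr rfl (fun m hm => if_pos hm)] at this

lemma tendsto_spread_bound (K : ℝ) :
    Tendsto (fun n : ℕ => ((n : ℝ) + 1) * (Real.exp 1 ^ 2 * ((n : ℝ) + 1) ^ 2) /
      tilt ^ (n / 256 + 1) * Real.exp (K * √n)) atTop (𝓝 0) := by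
  set d : ℝ := Real.log tilt / 256 with hd
  have hd0 : 0 < d := div_pos (Real.log_pos one_lt_tilt) (by norm_num)
  set r : ℝ := Real.exp (-(d / 2)) with hr
  have hr0 : 0 < r := Real.exp_pos _
  have hr1 : r < 1 := by rw [hr, Real.exp_lt_one_iff]; linarith
  have ht := tilt_pos
  have h1 : Tendsto (fun n : ℕ => (Real.exp 1 ^ 2 * Real.exp (K ^ 2 / (2 * d)) / r) *
      (((n + 1 : ℕ) : ℝ) ^ 3 * r ^ (n + 1))) atTop (𝓝 0) := by
    have := (tendsto_pow_const_mul_const_pow_of_lt_one 3 hr0.le hr1).comp (tendsto_add_atTop_nat 1)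
    have h2 := this.const_mul (Real.exp 1 ^ 2 * Real.exp (K ^ 2 / (2 * d)) / r)
    rwa [mul_zero] at h2
  refine squeeze_zero (fun n => by positivity) (fun n => ?_) h1
  have h2 : Real.exp (d * n) ≤ tilt ^ (n / 256 + 1) := by
    have h3 : (n : ℝ) ≤ 256 * ((n / 256 + 1 : ℕ) : ℝ) := by
      exact_mod_cast (by omega : n ≤ 256 * (n / 256 + 1))
    rw [← Real.exp_log ht, ← Real.exp_nat_mul, Real.exp_le_exp, hd]
    have := Real.log_pos one_lt_tilt
    nlinarith
  -- `K√n ≤ (d/2) n + K²/(2d)` by the inequality between the two means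
  have h4 : K * √n ≤ d / 2 * n + K ^ 2 / (2 * d) := by
    have h5 := Real.sq_sqrt (Nat.cast_nonneg n : (0 : ℝ) ≤ n)
    have h6 : d / 2 * n + K ^ 2 / (2 * d) - K * √n = (d * √n - K) ^ 2 / (2 * d) := by
      field_simp
      nlinarith
    have h7 : 0 ≤ (d * √n - K) ^ 2 / (2 * d) := by positivity
    linarith
  have h8 : Real.exp (K * √n) ≤ Real.exp (d * n) * r ^ n * Real.exp (K ^ 2 / (2 * d)) := by
    rw [hr, ← Real.exp_nat_mul, ← Real.exp_add, ← Real.exp_add, Real.exp_le_exp]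
    linarith
  calc _ ≤ ((n : ℝ) + 1) * (Real.exp 1 ^ 2 * ((n : ℝ) + 1) ^ 2) / Real.exp (d * n) *
        (Real.exp (d * n) * r ^ n * Real.exp (K ^ 2 / (2 * d))) := by gcongr
    _ = _ := by
        have := (Real.exp_pos (d * n)).ne'
        push_cast
        field_simp
        ring

end Asymptotics

/-! ### The asymptotic formula -/

section Conclusion

universe u

/-- The number of additive triples divided by the expected order of magnitude
`n!³ / n ^ (n - 1)`. -/
def tripleRatio (G : Type*) [AddCommGroup G] : ℝ :=
  (additiveTripleCount G : ℝ) / ((Nat.card G).factorial ^ 3 / (Nat.card G : ℝ) ^ (Nat.card G - 1))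

lemma additiveTripleCount_le (G : Type*) [AddCommGroup G] [Finite G] :
    additiveTripleCount G ≤ (Nat.card G ^ Nat.card G) ^ 2 := by
  refine (Set.ncard_le_ncard (Set.subset_univ _)).trans ?_
  rw [Set.ncard_univ, Nat.card_prod, Nat.card_fun, Nat.card_fin, pow_two]

lemma tripleRatio_eq (G : Type*) [AddCommGroup G] [Fintype G] (hodd : Odd (Fintype.card G)) :
    (tripleRatio G : ℂ) =
      ∑ m ∈ range (Fintype.card G / 256 + 1), sparseCubeSum (Fin (Nat.card G)) G m +
      1 / (Fintype.card G : ℂ) *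
        ∑ χ ∈ spreadTuples (Fin (Nat.card G)) G (Fintype.card G / 256), bijFourier χ ^ 3 := by
  have hc : Fintype.card (Fin (Nat.card G)) = Fintype.card G := by
    rw [Fintype.card_fin, Nat.card_eq_fintype_card]
  have hpos : 0 < Fintype.card G := Fintype.card_pos
  have h1 := sum_bijFourier_cube hc
  rw [ncard_triples, sum_bijFourier_cube_split hc hodd (M := Fintype.card G / 256)
    (by rw [hc]; omega), hc] at h1
  change _ = _ * (additiveTripleCount G : ℂ) at h1
  unfold tripleRatio
  rw [Nat.card_eq_fintype_card] at h1 ⊢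
  set n := Fintype.card G
  have hn : (n : ℂ) ≠ 0 := Nat.cast_ne_zero.2 hpos.ne'
  have hfac : (n.factorial : ℂ) ≠ 0 := Nat.cast_ne_zero.2 (Nat.factorial_ne_zero _)
  push_cast
  have hpow : (n : ℂ) ^ n = n * (n : ℂ) ^ (n - 1) := by
    rw [← pow_succ', Nat.sub_add_cancel hpos]
  rw [hpow] at h1
  field_simp
  linear_combination -h1

lemma abs_tripleRatio_sub_le {ε : ℝ} (hε : 0 < ε) : ∃ N : ℕ, ∀ (G : Type u) [AddCommGroup G]
    [Finite G], Odd (Nat.card G) → N ≤ Nat.card G →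
      |tripleRatio G - Real.exp (-1 / 2)| ≤ ε := by
  choose C hC using sparseCubeSum_limit.{0, u}
  obtain ⟨N₁, hN₁⟩ := uniform_sum_limit C (half_pos hε)
  obtain ⟨K, hK, hKn⟩ := exists_sum_smallWeight_le
  have hev := (tendsto_spread_bound K).eventually_le_const (half_pos hε)
  obtain ⟨N₂, hN₂⟩ := eventually_atTop.1 hev
  refine ⟨max N₁ N₂, fun G _ _ hodd hN => ?_⟩
  have := Fintype.ofFinite G
  have hcard : Nat.card G = Fintype.card G := Nat.card_eq_fintype_card
  have hc : Fintype.card (Fin (Nat.card G)) = Fintype.card G := by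
    rw [Fintype.card_fin, hcard]
  have hpos : 0 < Fintype.card G := Fintype.card_pos
  rw [hcard] at hodd hN
  have hn0 : (0 : ℝ) < Fintype.card G := by exact_mod_cast hpos
  have hmain := hN₁ (Fintype.card G) (le_of_max_le_left hN)
    (sparseCubeSum (Fin (Nat.card G)) G)
    (fun m hm => norm_sparseCubeSum_le hc hodd (by rw [hc]; exact hm))
    (fun m hm => by
      have := hC m (Fin (Nat.card G)) G hc hodd (by rw [hc]; exact hm)
      rwa [hc] at this)
  have hspread := sum_spreadTuples_le hc hK (by rw [hc]; exact hKn _ hpos) (Fintype.card G / 256)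
  rw [hc] at hspread
  have hmin := hN₂ (Fintype.card G) (le_of_max_le_right hN)
  have hsp : ‖1 / (Fintype.card G : ℂ) * ∑ χ ∈ spreadTuples (Fin (Nat.card G)) G
      (Fintype.card G / 256), bijFourier χ ^ 3‖ ≤ ε / 2 := by
    rw [norm_mul, norm_div, norm_one, Complex.norm_natCast]
    have h1 : ‖∑ χ ∈ spreadTuples (Fin (Nat.card G)) G (Fintype.card G / 256),
        bijFourier χ ^ 3‖ ≤ _ := (norm_sum_le _ _).trans
      ((Finset.sum_le_sum fun χ _ => (norm_pow _ 3).le).trans hspread)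
    refine (mul_le_mul_of_nonneg_left h1 (by positivity)).trans (le_trans (le_of_eq ?_) hmin)
    field_simp
  rw [← Real.norm_eq_abs, ← Complex.norm_real, Complex.ofReal_sub, tripleRatio_eq G hodd,
    add_sub_right_comm]
  refine (norm_add_le _ _).trans ?_
  linarith

/-- The errors in the asymptotic formula for all groups of odd order `n`. Their supremum is the
error term depending on `n` only. -/
def ratioErrors (n : ℕ) : Set ℝ :=
  {x | ∃ (G : Type u) (_ : AddCommGroup G) (_ : Finite G), Odd (Nat.card G) ∧ Nat.card G = n ∧
    x = |tripleRatio G - Real.exp (-1 / 2)|}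

lemma bddAbove_ratioErrors (n : ℕ) : BddAbove (ratioErrors.{u} n) := by
  refine ⟨((n ^ n) ^ 2 : ℕ) / ((n.factorial : ℝ) ^ 3 / (n : ℝ) ^ (n - 1)) + Real.exp (-1 / 2), ?_⟩
  rintro x ⟨G, _, _, _, rfl, rfl⟩
  refine (abs_sub _ _).trans ?_
  rw [abs_of_nonneg (Real.exp_pos _).le]
  refine add_le_add_left ?_ _
  unfold tripleRatio
  rw [abs_of_nonneg (by positivity)]
  gcongr
  exact additiveTripleCount_le G

lemma exists_uniform_error : ∃ δ : ℕ → ℝ, Tendsto δ atTop (𝓝 0) ∧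
    ∀ (G : Type u) [AddCommGroup G] [Finite G], Odd (Nat.card G) →
      |tripleRatio G - Real.exp (-1 / 2)| ≤ δ (Nat.card G) := by
  refine ⟨fun n => sSup (ratioErrors.{u} n), ?_, fun G inst₁ inst₂ hodd =>
    le_csSup (bddAbove_ratioErrors.{u} _) ⟨G, inst₁, inst₂, hodd, rfl, rfl⟩⟩
  rw [Metric.tendsto_atTop]
  intro ε hε
  obtain ⟨N, hN⟩ := abs_tripleRatio_sub_le.{u} (half_pos hε)
  refine ⟨N, fun n hn => ?_⟩
  have h0 : 0 ≤ sSup (ratioErrors.{u} n) := by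
    refine Real.sSup_nonneg ?_
    rintro x ⟨G, _, _, _, _, rfl⟩
    exact abs_nonneg _
  have h1 : sSup (ratioErrors.{u} n) ≤ ε / 2 := by
    refine Real.sSup_le ?_ (half_pos hε).le
    rintro x ⟨G, _, _, hodd, rfl, rfl⟩
    exact hN G hodd hn
  rw [Real.dist_eq, sub_zero, abs_of_nonneg h0]
  linarith

end Conclusion

end

end AdditiveTriples

theorem theorem2 :
    ∃ δ : ℕ → ℝ, Filter.Tendsto δ Filter.atTop (nhds 0) ∧
      ∀ (G : Type*) [AddCommGroup G] [Finite G], Odd (Nat.card G) →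
        |(additiveTripleCount G : ℝ) -
            Real.exp (-1 / 2) *
              ((Nat.card G).factorial ^ 3 / (Nat.card G : ℝ) ^ (Nat.card G - 1))| ≤
          δ (Nat.card G) *
            ((Nat.card G).factorial ^ 3 / (Nat.card G : ℝ) ^ (Nat.card G - 1)) := by
  obtain ⟨δ, hδ, h⟩ := AdditiveTriples.exists_uniform_error
  refine ⟨δ, hδ, fun G _ _ hodd => ?_⟩
  have hpos : (0 : ℝ) < (Nat.card G).factorial ^ 3 / (Nat.card G : ℝ) ^ (Nat.card G - 1) := by
    have h1 : (0 : ℝ) < Nat.card G := by exact_mod_cast Nat.card_pos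
    have h2 : (0 : ℝ) < (Nat.card G).factorial := by exact_mod_cast Nat.factorial_pos _
    positivity
  have e : (additiveTripleCount G : ℝ) = AdditiveTriples.tripleRatio G *
      ((Nat.card G).factorial ^ 3 / (Nat.card G : ℝ) ^ (Nat.card G - 1)) := by
    rw [AdditiveTriples.tripleRatio, div_mul_cancel₀ _ hpos.ne']
  rw [e, ← sub_mul, abs_mul, abs_of_pos hpos]
  exact mul_le_mul_of_nonneg_right (h G hodd) hpos.le
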